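/- Conventions. Rational codes and sequences are computable in the sense of Turing machines. A real $\alpha$ is computable if a computable sequence of rationals $r_k$ satisfies $|\alpha-r_k|<2^{-k}$, and left-computable if it is the limit of a nondecreasing computable sequence of rationals; points and sequences of points of $\mathbb{R}^2$ are computable if they have computable rational approximations in the same sense (computable single, resp. double, sequences). Let $D$ be $\mathbb{R}^2$ or a closed disk centered at the origin with rational radius. A continuous field $v:D\to\mathbb{R}^2$ is computable if there is a computable double sequence $(P_{k,l})$ of pairs of polynomials with rational coefficients with $|v_i-P_{k,l,i}|<2^{-k}$ on $D\cap\overline{B}(0,2^l)$ for $i=1,2$. A relatively open set $W\subseteq D$ is computable in $D$ if $W$ is the intersection of $D$ with the union of a computable sequence of open balls with rational centers and radii, and $D\setminus W$ is empty or has a computable sequence of points as a dense subset. For a field $v$ on $D$ and an equilibrium $s$ (a point with $v(s)=0$), the basin $W_s$ is the set of all $x\in D$ such that a solution of $\varphi'=v(\varphi)$, $\varphi(0)=x$, exists in $D$ for all $t\ge 0$ and converges to $s$ as $t\to\infty$; $s$ is a sink if $W_s$ contains a neighborhood of $s$ in $D$. Let $K$ be the closed disk of radius $3$ centered at the origin,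 and let $\mathcal{V}(K)$ be the set of $C^1$ fields $v:K\to\mathbb{R}^2$ with $\langle x,v(x)\rangle<0$ for all $x\in\partial K$, with the topology of uniform convergence (the $C$-norm). For $f:\mathbb{R}\to\mathbb{R}$, the field with radial profile $f$ is $(x_1,x_2)\mapsto\bigl(x_1f(x_1^2+x_2^2)-x_2,\;x_2f(x_1^2+x_2^2)+x_1\bigr)$. For $f:\mathbb{R}\to\mathbb{R}$, $\alpha\in\mathbb{R}$ and $h:\mathbb{R}^2\to\mathbb{R}^2$, let $\mathcal{P}(f,\alpha,h)$ be the following property: $h$ is the field with radial profile $f$; $h$ is computable and $C^\infty$; $h|_K\in\mathcal{V}(K)$; the origin, a computable point, is the unique equilibrium of $h$ in $\mathbb{R}^2$ and is a sink of $h$; $\alpha$ is left-computable but not computable; and the basin of the origin is $W_0=\{(x_1,x_2)\in\mathbb{R}^2 : x_1^2+x_2^2<\alpha\}$, which is not a computable open subset of $\mathbb{R}^2$. **Theorem.** There exist a $C^\infty$ function $f:\mathbb{R}\to\mathbb{R}$, a real number $\alpha$ and a field $h:\mathbb{R}^2\to\mathbb{R}^2$ such that: 1. $\mathcal{P}(f,\alpha,h)$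 holds. 2. For every $C$-neighborhood $U$ of $h|_K$ in $\mathcal{V}(K)$ there are a rational $\delta\in(0,1)$ and a field $\hat h:\mathbb{R}^2\to\mathbb{R}^2$ such that $\hat h|_K\in U$, $\hat h|_K\neq h|_K$ and $\mathcal{P}(f(\cdot-\delta),\alpha+\delta,\hat h)$ holds. So $\hat h$ is again a computable $C^\infty$ field with a unique computable equilibrium, which is a sink whose basin is non-computable. 3. The basin map $(v,s)\mapsto W_s$, defined on the pairs of a field $v\in\mathcal{V}(K)$ and a sink $s$ of $v$ (with the $C$-norm topology on fields and the usual topology on points), is semi-robustly non-computable at $(h|_K,0)$: the pair $(h|_K,0)$ is computable, its basin is not computable in $K$, and every neighborhood of $(h|_K,0)$ contains a pair $(v,s)\neq(h|_K,0)$ with $v$ and $s$ computable whose basin $W_s$ is not computable in $K$. -/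

import Mathlib

open Set Filter Topology
open scoped ContDiff

/-- The Euclidean plane. -/
abbrev Plane : Type := EuclideanSpace ℝ (Fin 2)

/-- The closed disk of radius `R` centered at the origin. -/
abbrev disk (R : ℝ) : Set Plane := Metric.closedBall 0 R

/-! ### Computability of reals, points, open sets and vector fields -/

/-- Codes for rational numbers; computability of sequences of codes is Mathlib's `Computable`. -/
abbrev RatCode : Type := ℕ × ℕ × ℕ

/-- The rational number `(a - b) / (c + 1)` coded by `(a, b, c)`. Every rational has a code. -/
def RatCode.val (c : RatCode) : ℚ := ((c.1 : ℚ) - (c.2.1 : ℚ)) / ((c.2.2 : ℚ) + 1)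

/-- Codes for points with rational coordinates. -/
abbrev RatPointCode : Type := RatCode × RatCode

/-- The point of the plane coded by a pair of codes of rationals. -/
noncomputable def RatPointCode.val (p : RatPointCode) : Plane :=
  !₂[((RatCode.val p.1 : ℚ) : ℝ), ((RatCode.val p.2 : ℚ) : ℝ)]

/-- Codes for polynomials in two variables with rational coefficients: a finite list of terms
`(q, (i, j))`, standing for `q * X ^ i * Y ^ j`. -/
abbrev PolyCode : Type := List (RatCode × (ℕ × ℕ))

/-- The value at `x` of the coded polynomial. -/
noncomputable def PolyCode.eval (P : PolyCode) (x : Plane) : ℝ :=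
  (P.map fun m => ((RatCode.val m.1 : ℚ) : ℝ) * x 0 ^ m.2.1 * x 1 ^ m.2.2).sum

/-- A real number is computable if some computable sequence of rationals `r k` satisfies
`|α - r k| < 2 ^ (-k)`. -/
def IsComputableReal (α : ℝ) : Prop :=
  ∃ r : ℕ → RatCode, Computable r ∧ ∀ k, |α - ((r k).val : ℝ)| < (1 / 2 : ℝ) ^ k

/-- A real number is left-computable if it is the limit of a nondecreasing computable sequence
of rationals. -/
def IsLeftComputableReal (α : ℝ) : Prop :=
  ∃ r : ℕ → RatCode, Computable r ∧ Monotone (fun k => (r k).val) ∧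
    Tendsto (fun k => ((r k).val : ℝ)) atTop (𝓝 α)

/-- A sequence of points of the plane is computable if it has a computable double sequence of
rational approximations. -/
def IsComputablePointSeq (x : ℕ → Plane) : Prop :=
  ∃ r : ℕ × ℕ → RatPointCode, Computable r ∧
    ∀ j k, ‖x j - RatPointCode.val (r (j, k))‖ < (1 / 2 : ℝ) ^ k

/-- A point of the plane is computable if it has a computable sequence of rational
approximations. -/
def IsComputablePoint (x : Plane) : Prop :=
  ∃ r : ℕ → RatPointCode, Computable r ∧
    ∀ k, ‖x - RatPointCode.val (r k)‖ < (1 / 2 : ℝ) ^ k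

/-- `W` is an r.e. open subset of `D`: the trace on `D` of the union of a computable sequence of
rational open balls (a ball of nonpositive radius is empty). -/
def IsREOpen (D W : Set Plane) : Prop :=
  ∃ (a : ℕ → RatPointCode) (r : ℕ → RatCode), Computable a ∧ Computable r ∧
    W = D ∩ ⋃ k, Metric.ball (RatPointCode.val (a k)) ((r k).val : ℝ)

/-- `W` is a co-r.e. open subset of `D`: its complement in `D` is empty or contains a computable
sequence which is dense in it. -/
def IsCoREOpen (D W : Set Plane) : Prop :=
  D \ W = ∅ ∨ ∃ x : ℕ → Plane, IsComputablePointSeq x ∧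
    (∀ j, x j ∈ D \ W) ∧ D \ W ⊆ closure (range x)

/-- Computable open subsets of `D`. For `D = univ` these are the computable open subsets of the
plane. -/
def IsComputableOpen (D W : Set Plane) : Prop := IsREOpen D W ∧ IsCoREOpen D W

/-- A continuous vector field on `D` is computable if there is a computable double sequence of
pairs of rational polynomials `P (k, l)` whose distances to the components of the field are less
than `2 ^ (-k)` on the part of `D` in the closed ball of radius `2 ^ l`. -/
def IsComputableField {D : Set Plane} (v : C(D, Plane)) : Prop :=
  ∃ P : ℕ × ℕ → PolyCode × PolyCode, Computable P ∧
    ∀ (k l : ℕ) (x : D), ‖(x : Plane)‖ ≤ 2 ^ l →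
      |v x 0 - (P (k, l)).1.eval x| < (1 / 2 : ℝ) ^ k ∧
        |v x 1 - (P (k, l)).2.eval x| < (1 / 2 : ℝ) ^ k

/-! ### Sinks and basins of attraction -/

/-- `φ` (restricted to `t ≥ 0`) is a trajectory in `D` of `x' = v x`. -/
def IsTrajectory {D : Set Plane} (v : C(D, Plane)) (φ : ℝ → Plane) : Prop :=
  ∀ t, 0 ≤ t → ∃ y : D, (y : Plane) = φ t ∧ HasDerivWithinAt φ (v y) (Ici 0) t

/-- The set of points of `D` whose trajectory converges to `s` as `t → ∞`. -/
def basin {D : Set Plane} (v : C(D, Plane)) (s : Plane) : Set Plane :=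
  {x | ∃ φ : ℝ → Plane, φ 0 = x ∧ IsTrajectory v φ ∧ Tendsto φ atTop (𝓝 s)}

/-- A sink is an equilibrium with a neighborhood (in `D`) contained in its basin. -/
def IsSink {D : Set Plane} (v : C(D, Plane)) (s : Plane) : Prop :=
  (∃ y : D, (y : Plane) = s ∧ v y = 0) ∧ basin v s ∈ 𝓝[D] s

/-- The `C¹` vector fields on the disk of radius `R` which point inward along its boundary circle.
The topology of `C(disk R, Plane)` is that of uniform convergence, as the disk is compact. -/
def inwardFields (R : ℝ) : Set C(disk R, Plane) :=
  {v | (∃ g : Plane → Plane, ContDiffOn ℝ 1 g (disk R) ∧ ∀ x : disk R, g x = v x) ∧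
    ∀ x : disk R, ‖(x : Plane)‖ = R → inner ℝ (x : Plane) (v x) < 0}

/-! ### Semi-robust non-computability -/

/-- Semi-robust non-computability at `x` of a map `Φ : X → Y`, where `cX` and `cY` single out the
computable elements of `X` and of `Y`. -/
def SemiRobustlyNoncomputableAt {X Y : Type*} [TopologicalSpace X] (cX : X → Prop) (cY : Y → Prop)
    (Φ : X → Y) (x : X) : Prop :=
  cX x ∧ ¬ cY (Φ x) ∧ ∀ U ∈ 𝓝 x, ∃ y ∈ U, cX y ∧ y ≠ x ∧ ¬ cY (Φ y)

/-- Pairs of an inward pointing `C¹` field on the disk of radius `R` and a sink of it, with the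
topology given by the `C`-norm on fields and the usual topology on points. -/
abbrev FieldWithSink (R : ℝ) : Type :=
  {p : C(disk R, Plane) × Plane // p.1 ∈ inwardFields R ∧ IsSink p.1 p.2}

/-- The computable elements: both the field and the sink are computable. -/
def FieldWithSink.IsComputable {R : ℝ} (p : FieldWithSink R) : Prop :=
  IsComputableField p.1.1 ∧ IsComputablePoint p.1.2

/-- The basin map: it sends a field with a sink to the basin of attraction of the sink. -/
def basinMap (R : ℝ) (p : FieldWithSink R) : Set Plane := basin p.1.1 p.1.2

/-! ### The fields of the theorem -/

/-- The planar field with radial profile `f`. -/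
noncomputable def radialField (f : ℝ → ℝ) (x : Plane) : Plane :=
  !₂[x 0 * f (x 0 ^ 2 + x 1 ^ 2) - x 1, x 1 * f (x 0 ^ 2 + x 1 ^ 2) + x 0]

/-- `h` is a computable `C^∞` field on the plane with radial profile `f`, it points inward along
the boundary of the disk of radius `3`, the origin is its unique equilibrium and a sink, and the
basin of the origin is the non-computable disk `x₁² + x₂² < α`, where `α` is left-computable but
not computable. -/
structure HasNoncomputableBasin (f : ℝ → ℝ) (α : ℝ) (h : C(Plane, Plane)) : Prop where
  profile : ∀ x, h x = radialField f x
  smooth : ContDiff ℝ ∞ h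
  computable : IsComputableField (h.restrict univ)
  inward : h.restrict (disk 3) ∈ inwardFields 3
  equilibrium : ∀ x, h x = 0 ↔ x = 0
  computable_equilibrium : IsComputablePoint 0
  sink : IsSink (h.restrict univ) 0
  left_computable : IsLeftComputableReal α
  not_computable : ¬ IsComputableReal α
  basin_eq : basin (h.restrict univ) 0 = {x | x 0 ^ 2 + x 1 ^ 2 < α}
  basin_not_computable : ¬ IsComputableOpen univ (basin (h.restrict univ) 0)

/-!
The profile is `f w = -ψ (w - 4) - ∑ₛ 2 ^ (-s - 1) ψ (aₛ - w)`, where `ψ u` is `exp (-1 / u)` for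
`u > 0` and `0` for `u ≤ 0`, and `aₛ` is a nondecreasing computable sequence of rationals whose limit
`α ∈ [1, 2]` is a Specker number. As `ψ` is positive exactly on `(0, ∞)`, `f` is negative on
`(-∞, α)` and on `(4, ∞)` and vanishes on `[α, 4]`. The flatness of `ψ` is essential: `f` is smooth
and computable although its smallest zero is not a computable number.

* Dynamics. The squared radius `w` of a trajectory satisfies `w' = 2 w f(w)`. If `w` starts below
  `α`, it decays exponentially (`norm_sq_le_and_tendsto_zero`); if it starts at or above `α`, the
  Lipschitz bound of `f` and `f α = 0` prevent it from going below `α` (`le_norm_sq_of_zero`).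
  Solutions are global because the field has linear growth. So the basin of the origin is the disk
  `x₁² + x₂² < α` (`IsSinkProfile.basin_eq`).
* Computability of the field. The rational numbers `(n u / (n u + 1)) ^ n` lie between `ψ u` and
  `ψ (u + 1 / n)`, so `ψ`, and with it `f`, can be computed at rational points. Bernstein
  polynomials turn the values of a Lipschitz function at rational points into polynomial
  approximations with an explicit error (`abs_sub_bernstein_lt`,
  `IsComputableOnRat.isComputableField`). Only the existence of a Lipschitz constant is needed, as a
  fixed natural number may be built into an algorithm.
* Non-computability of the basin. A computable sequence that is dense in the complement of the disk
  yields computable upper bounds converging to `α` (`IsCoREOpen.isRightComputableReal`). Together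
  with the approximations `aₛ` from below they would decide the halting problem: a program that has
  not halted at a stage where the gap is smaller than its weight never halts
  (`Specker.not_isRightComputableReal_limit`).
* Robustness. Replacing `f` by `f (· - δ)` with rational `δ ∈ (0, 1)` replaces `α` by `α + δ`, which
  keeps all these properties, and the fields converge uniformly on the disk of radius `3` as `δ`
  tends to `0` (`Specker.tendsto_restrict_field`).
-/

/-! ### Arithmetic on codes -/

theorem Primrec.nat_pow : Primrec₂ ((· ^ ·) : ℕ → ℕ → ℕ) :=
  Primrec₂.unpaired'.1 Nat.Primrec.pow

theorem Primrec.nat_factorial : Primrec Nat.factorial := by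
  refine (Primrec.nat_rec' (f := fun n : ℕ => n) (g := fun _ => 1)
    (h := fun _ p => (p.1 + 1) * p.2) Primrec.id (Primrec.const 1) ?_).of_eq fun n => ?_
  · exact Primrec.nat_mul.comp (Primrec.succ.comp (Primrec.fst.comp Primrec.snd))
      (Primrec.snd.comp Primrec.snd)
  · induction n with
    | zero => rfl
    | succ n ih => simp only [Nat.factorial_succ, ← ih]

namespace RatCode

/-- The code of a natural number divided by a natural number; it has the right value
if `b ≠ 0`. -/
def ofFrac (a b : ℕ) : RatCode := (a, 0, b - 1)

/-- Addition of rationals on codes. -/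
def add (x y : RatCode) : RatCode :=
  (x.1 * (y.2.2 + 1) + y.1 * (x.2.2 + 1), x.2.1 * (y.2.2 + 1) + y.2.1 * (x.2.2 + 1),
    (x.2.2 + 1) * (y.2.2 + 1) - 1)

/-- Multiplication of rationals on codes. -/
def mul (x y : RatCode) : RatCode :=
  (x.1 * y.1 + x.2.1 * y.2.1, x.1 * y.2.1 + x.2.1 * y.1, (x.2.2 + 1) * (y.2.2 + 1) - 1)

/-- Negation of rationals on codes. -/
def neg (x : RatCode) : RatCode := (x.2.1, x.1, x.2.2)

theorem val_ofFrac {a b : ℕ} (hb : b ≠ 0) : (ofFrac a b).val = (a : ℚ) / b := by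
  obtain ⟨c, rfl⟩ := Nat.exists_eq_succ_of_ne_zero hb
  simp [ofFrac, val]

theorem val_add (x y : RatCode) : (add x y).val = x.val + y.val := by
  have h : 1 ≤ (x.2.2 + 1) * (y.2.2 + 1) := Nat.one_le_iff_ne_zero.2 (by positivity)
  have hx : (x.2.2 : ℚ) + 1 ≠ 0 := by positivity
  have hy : (y.2.2 : ℚ) + 1 ≠ 0 := by positivity
  simp only [add, val]
  push_cast [Nat.cast_sub h]
  rw [sub_add_cancel]
  field_simp
  ring

theorem val_mul (x y : RatCode) : (mul x y).val = x.val * y.val := by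
  have h : 1 ≤ (x.2.2 + 1) * (y.2.2 + 1) := Nat.one_le_iff_ne_zero.2 (by positivity)
  have hx : (x.2.2 : ℚ) + 1 ≠ 0 := by positivity
  have hy : (y.2.2 : ℚ) + 1 ≠ 0 := by positivity
  simp only [mul, val]
  push_cast [Nat.cast_sub h]
  rw [sub_add_cancel]
  field_simp
  ring

theorem val_neg (x : RatCode) : (neg x).val = -x.val := by
  simp only [neg, val]
  ring

theorem exists_val_eq (q : ℚ) : ∃ c : RatCode, c.val = q := by
  refine ⟨(q.num.toNat, (-q.num).toNat, q.den - 1), ?_⟩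
  have h1 : ((q.num.toNat : ℚ) - ((-q.num).toNat : ℚ)) = q.num := by
    have := Int.toNat_sub_toNat_neg q.num
    exact_mod_cast this
  have h2 : ((q.den - 1 : ℕ) : ℚ) + 1 = q.den := by
    have := q.pos
    norm_cast
    omega
  simp only [val, h1, h2]
  exact Rat.num_div_den q

theorem val_lt_iff (x y : RatCode) : x.val < y.val ↔
    x.1 * (y.2.2 + 1) + y.2.1 * (x.2.2 + 1) < y.1 * (x.2.2 + 1) + x.2.1 * (y.2.2 + 1) := by
  have hx : (0 : ℚ) < (x.2.2 : ℚ) + 1 := by positivity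
  have hy : (0 : ℚ) < (y.2.2 : ℚ) + 1 := by positivity
  rw [val, val, div_lt_div_iff₀ hx hy, ← Nat.cast_lt (α := ℚ)]
  push_cast
  constructor <;> intro h <;> linarith

theorem primrec_ofFrac : Primrec₂ ofFrac :=
  Primrec.fst.pair ((Primrec.const 0).pair (Primrec.nat_sub.comp Primrec.snd (Primrec.const 1)))

theorem primrec_den : Primrec fun x : RatCode => x.2.2 + 1 :=
  Primrec.succ.comp (Primrec.snd.comp Primrec.snd)

theorem primrec_pos : Primrec fun x : RatCode => x.1 := Primrec.fst

theorem primrec_neg_part : Primrec fun x : RatCode => x.2.1 := Primrec.fst.comp Primrec.snd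

theorem primrec_add : Primrec₂ add := by
  have m := fun {f g : RatCode × RatCode → ℕ} (hf : Primrec f) (hg : Primrec g) =>
    Primrec.nat_mul.comp hf hg
  have f : Primrec (Prod.fst : RatCode × RatCode → RatCode) := Primrec.fst
  have s : Primrec (Prod.snd : RatCode × RatCode → RatCode) := Primrec.snd
  exact (Primrec.nat_add.comp (m (primrec_pos.comp f) (primrec_den.comp s))
    (m (primrec_pos.comp s) (primrec_den.comp f))).pair
    ((Primrec.nat_add.comp (m (primrec_neg_part.comp f) (primrec_den.comp s))
    (m (primrec_neg_part.comp s) (primrec_den.comp f))).pair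
    (Primrec.nat_sub.comp (m (primrec_den.comp f) (primrec_den.comp s)) (Primrec.const 1)))

theorem primrec_mul : Primrec₂ mul := by
  have m := fun {f g : RatCode × RatCode → ℕ} (hf : Primrec f) (hg : Primrec g) =>
    Primrec.nat_mul.comp hf hg
  have f : Primrec (Prod.fst : RatCode × RatCode → RatCode) := Primrec.fst
  have s : Primrec (Prod.snd : RatCode × RatCode → RatCode) := Primrec.snd
  exact (Primrec.nat_add.comp (m (primrec_pos.comp f) (primrec_pos.comp s))
    (m (primrec_neg_part.comp f) (primrec_neg_part.comp s))).pair
    ((Primrec.nat_add.comp (m (primrec_pos.comp f) (primrec_neg_part.comp s))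
    (m (primrec_neg_part.comp f) (primrec_pos.comp s))).pair
    (Primrec.nat_sub.comp (m (primrec_den.comp f) (primrec_den.comp s)) (Primrec.const 1)))

theorem primrec_neg : Primrec neg :=
  primrec_neg_part.pair (primrec_pos.pair (Primrec.snd.comp Primrec.snd))

theorem primrecRel_val_lt : PrimrecRel fun x y : RatCode => x.val < y.val := by
  have m := fun {f g : RatCode × RatCode → ℕ} (hf : Primrec f) (hg : Primrec g) =>
    Primrec.nat_mul.comp hf hg
  have f : Primrec (Prod.fst : RatCode × RatCode → RatCode) := Primrec.fst
  have s : Primrec (Prod.snd : RatCode × RatCode → RatCode) := Primrec.snd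
  refine (Primrec.nat_lt.comp
    (Primrec.nat_add.comp (m (primrec_pos.comp f) (primrec_den.comp s))
      (m (primrec_neg_part.comp s) (primrec_den.comp f)))
    (Primrec.nat_add.comp (m (primrec_pos.comp s) (primrec_den.comp f))
      (m (primrec_neg_part.comp f) (primrec_den.comp s)))).of_eq fun p => ?_
  exact (val_lt_iff p.1 p.2).symm

/-- The code of `2 ^ (-k)`. -/
def halfPow (k : ℕ) : RatCode := ofFrac 1 (2 ^ k)

theorem val_halfPow (k : ℕ) : (halfPow k).val = (1 / 2 : ℚ) ^ k := by
  rw [halfPow, val_ofFrac (by positivity)]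
  simp

theorem primrec_halfPow : Primrec halfPow :=
  primrec_ofFrac.comp (Primrec.const 1) (Primrec.nat_pow.comp (Primrec.const 2) Primrec.id)

/-- The code of a finite sum of coded rationals. -/
def sum (c : ℕ → RatCode) (n : ℕ) : RatCode := Nat.rec (0, 0, 0) (fun j s => add s (c j)) n

theorem val_sum (c : ℕ → RatCode) (n : ℕ) :
    (sum c n).val = ∑ j ∈ Finset.range n, (c j).val := by
  induction n with
  | zero => simp [sum, val]
  | succ n ih => rw [Finset.sum_range_succ, ← ih]; exact val_add _ _

theorem computable_sum {α : Type*} [Primcodable α] {c : α → ℕ → RatCode} {n : α → ℕ}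
    (hc : Computable₂ c) (hn : Computable n) : Computable fun a => sum (c a) (n a) :=
  Computable.nat_rec (h := fun a p => add p.2 (c a p.1)) hn (Computable.const (0, 0, 0))
    (primrec_add.to_comp.comp (Computable.snd.comp Computable.snd)
      (hc.comp Computable.fst (Computable.fst.comp Computable.snd)))

end RatCode

namespace PolyCode

theorem eval_nil (x : Plane) : eval [] x = 0 := by simp [eval]

theorem eval_cons (m : RatCode × (ℕ × ℕ)) (P : PolyCode) (x : Plane) :
    eval (m :: P) x = ((RatCode.val m.1 : ℚ) : ℝ) * x 0 ^ m.2.1 * x 1 ^ m.2.2 + eval P x := by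
  simp [eval]

theorem eval_append (P Q : PolyCode) (x : Plane) :
    eval (P ++ Q) x = eval P x + eval Q x := by
  simp [eval]

/-- Multiplication of monomials on codes. -/
def mulTerm (m m' : RatCode × (ℕ × ℕ)) : RatCode × (ℕ × ℕ) :=
  (RatCode.mul m.1 m'.1, (m.2.1 + m'.2.1, m.2.2 + m'.2.2))

/-- Multiplication of polynomials on codes. -/
def mul (P Q : PolyCode) : PolyCode := P.flatMap fun m => Q.map (mulTerm m)

theorem eval_mul (P Q : PolyCode) (x : Plane) : eval (mul P Q) x = eval P x * eval Q x := by
  have key : ∀ m, eval (Q.map (mulTerm m)) x =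
      ((RatCode.val m.1 : ℚ) : ℝ) * x 0 ^ m.2.1 * x 1 ^ m.2.2 * eval Q x := by
    intro m
    induction Q with
    | nil => simp [eval_nil]
    | cons m' Q ih =>
      rw [List.map_cons, eval_cons, eval_cons, ih]
      simp only [mulTerm, RatCode.val_mul, Rat.cast_mul, pow_add]
      ring
  induction P with
  | nil => simp [mul, eval_nil]
  | cons m P ih =>
    have : mul (m :: P) Q = Q.map (mulTerm m) ++ mul P Q := rfl
    rw [this, eval_append, ih, key, eval_cons]
    ring

theorem primrec_mul : Primrec₂ mul := by
  refine Primrec.list_flatMap (f := fun p : PolyCode × PolyCode => p.1)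
    (g := fun p m => p.2.map (mulTerm m)) Primrec.fst ?_
  refine Primrec.list_map (f := fun q : (PolyCode × PolyCode) × (RatCode × (ℕ × ℕ)) => q.1.2)
    (g := fun q m' => mulTerm q.2 m') (Primrec.snd.comp Primrec.fst) ?_
  have a : Primrec fun r : ((PolyCode × PolyCode) × (RatCode × (ℕ × ℕ))) × (RatCode × (ℕ × ℕ)) =>
      r.1.2 := Primrec.snd.comp Primrec.fst
  have b : Primrec fun r : ((PolyCode × PolyCode) × (RatCode × (ℕ × ℕ))) × (RatCode × (ℕ × ℕ)) =>
      r.2 := Primrec.snd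
  exact (RatCode.primrec_mul.comp (Primrec.fst.comp a) (Primrec.fst.comp b)).pair
    ((Primrec.nat_add.comp (Primrec.fst.comp (Primrec.snd.comp a))
      (Primrec.fst.comp (Primrec.snd.comp b))).pair
    (Primrec.nat_add.comp (Primrec.snd.comp (Primrec.snd.comp a))
      (Primrec.snd.comp (Primrec.snd.comp b))))

/-- Powers of polynomials on codes. -/
def pow (P : PolyCode) (n : ℕ) : PolyCode := Nat.rec [((1, 0, 0), (0, 0))] (fun _ Q => mul Q P) n

theorem eval_pow (P : PolyCode) (n : ℕ) (x : Plane) : eval (pow P n) x = eval P x ^ n := by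
  induction n with
  | zero => simp [pow, eval, RatCode.val]
  | succ n ih =>
    rw [pow_succ, ← ih]
    exact eval_mul _ _ _

theorem primrec_pow : Primrec₂ pow :=
  Primrec.nat_rec' (f := fun p : PolyCode × ℕ => p.2) (g := fun _ => [((1, 0, 0), (0, 0))])
    (h := fun p r => mul r.2 p.1) Primrec.snd (Primrec.const _)
    (primrec_mul.comp (Primrec.snd.comp Primrec.snd) (Primrec.fst.comp Primrec.fst))

/-- The code of a finite sum of coded polynomials. -/
def sum (P : ℕ → PolyCode) (n : ℕ) : PolyCode := Nat.rec [] (fun j S => S ++ P j) n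

theorem eval_sum (P : ℕ → PolyCode) (n : ℕ) (x : Plane) :
    eval (sum P n) x = ∑ j ∈ Finset.range n, eval (P j) x := by
  induction n with
  | zero => simp [sum, eval_nil]
  | succ n ih => rw [Finset.sum_range_succ, ← ih]; exact eval_append _ _ _

theorem computable_sum {α : Type*} [Primcodable α] {P : α → ℕ → PolyCode} {n : α → ℕ}
    (hP : Computable₂ P) (hn : Computable n) : Computable fun a => sum (P a) (n a) :=
  Computable.nat_rec (h := fun a p => p.2 ++ P a p.1) hn (Computable.const [])
    (Primrec.list_append.to_comp.comp (Computable.snd.comp Computable.snd)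
      (hP.comp Computable.fst (Computable.fst.comp Computable.snd)))

end PolyCode

/-! ### Computable fields from rational values of a Lipschitz profile -/

theorem sq_add_sq_eq_norm_sq (x : Plane) : x 0 ^ 2 + x 1 ^ 2 = ‖x‖ ^ 2 := by
  rw [EuclideanSpace.norm_sq_eq]
  simp [Fin.sum_univ_two]

/-- The values of `g` at rational points can be computed to any precision. -/
def IsComputableOnRat (g : ℝ → ℝ) : Prop :=
  ∃ F : RatCode × ℕ → RatCode, Computable F ∧
    ∀ q k, |g (q.val : ℝ) - ((F (q, k)).val : ℝ)| < (1 / 2 : ℝ) ^ k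

/-- Quantitative Weierstrass approximation of a Lipschitz function by Bernstein polynomials of
degree `N ^ 2` whose coefficients are known up to an error `η`. -/
theorem abs_sub_bernstein_lt {g : ℝ → ℝ} {L R : ℝ} (hL : ∀ x y, |g x - g y| ≤ L * |x - y|)
    (hL0 : 0 ≤ L) (hR : 0 ≤ R) {N : ℕ} (hN : N ≠ 0) {c : ℕ → ℝ} {η : ℝ}
    (hc : ∀ j : ℕ, |g (R * (j / (N ^ 2 : ℕ))) - c j| < η) {t : ℝ} (ht : t ∈ Icc (0 : ℝ) 1) :
    |g (R * t) - ∑ j ∈ Finset.range (N ^ 2 + 1),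
      c j * ((N ^ 2).choose j * t ^ j * (1 - t) ^ (N ^ 2 - j))| < R * L / (2 * N) + η := by
  set n := N ^ 2 with hn
  have hn0 : n ≠ 0 := pow_ne_zero 2 hN
  have hNpos : (0 : ℝ) < N := Nat.cast_pos.2 (Nat.pos_of_ne_zero hN)
  set b : ℕ → ℝ := fun j => n.choose j * t ^ j * (1 - t) ^ (n - j) with hb
  have hb0 : ∀ j, 0 ≤ b j := fun j => by
    have h1 := ht.1
    have h2 : 0 ≤ 1 - t := sub_nonneg.2 ht.2
    simp only [hb]
    positivity
  have hb1 : ∑ j ∈ Finset.range (n + 1), b j = 1 := by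
    have := bernstein.probability n ⟨t, ht⟩
    simp only [bernstein_apply] at this
    rw [← this, Finset.sum_range]
  have hvar : ∑ j ∈ Finset.range (n + 1), (t - j / n) ^ 2 * b j = t * (1 - t) / n := by
    have := bernstein.variance hn0 ⟨t, ht⟩
    simp only [bernstein_apply, bernstein.z] at this
    rw [← this, Finset.sum_range]
  have hsplit : g (R * t) - ∑ j ∈ Finset.range (n + 1), c j * b j =
      ∑ j ∈ Finset.range (n + 1), (g (R * t) - g (R * (j / n)) + (g (R * (j / n)) - c j)) * b j := by
    have : g (R * t) = ∑ j ∈ Finset.range (n + 1), g (R * t) * b j := by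
      rw [← Finset.mul_sum, hb1, mul_one]
    conv_lhs => rw [this]
    rw [← Finset.sum_sub_distrib]
    exact Finset.sum_congr rfl fun j _ => by ring
  -- `|u| ≤ N u² + 1 / (4 N)` turns the variance into a bound of the first absolute moment
  have habs : ∀ u : ℝ, |u| ≤ N * u ^ 2 + 1 / (4 * N) := fun u => by
    rw [← sq_abs u]
    have : 0 ≤ (2 * N * |u| - 1) ^ 2 / (4 * N) := by positivity
    have h2 : (2 * N * |u| - 1) ^ 2 / (4 * N) = N * |u| ^ 2 + 1 / (4 * N) - |u| := by
      field_simp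
      ring
    linarith
  have hmoment : ∑ j ∈ Finset.range (n + 1), |t - j / n| * b j ≤ 1 / (2 * N) := by
    calc _ ≤ ∑ j ∈ Finset.range (n + 1),
          (N * ((t - j / n) ^ 2 * b j) + 1 / (4 * N) * b j) := by
          refine Finset.sum_le_sum fun j _ => ?_
          have := mul_le_mul_of_nonneg_right (habs (t - j / n)) (hb0 j)
          linarith
      _ = N * (t * (1 - t) / n) + 1 / (4 * N) := by
          rw [Finset.sum_add_distrib, ← Finset.mul_sum, ← Finset.mul_sum, hvar, hb1, mul_one]
      _ ≤ N * ((1 / 4) / n) + 1 / (4 * N) := by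
          gcongr
          nlinarith [sq_nonneg (t - 1 / 2)]
      _ = 1 / (2 * N) := by
          rw [hn]
          push_cast
          field_simp
          norm_num
  have hterm : ∀ j : ℕ, |(g (R * t) - g (R * (j / n)) + (g (R * (j / n)) - c j)) * b j| ≤
      R * L * (|t - j / n| * b j) + |g (R * (j / n)) - c j| * b j := fun j => by
    rw [abs_mul, abs_of_nonneg (hb0 j)]
    have h1 := hL (R * t) (R * (j / n))
    rw [← mul_sub, abs_mul, abs_of_nonneg hR] at h1
    have h2 := abs_add_le (g (R * t) - g (R * (j / n))) (g (R * (j / n)) - c j)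
    have := mul_le_mul_of_nonneg_right (h2.trans (add_le_add_left h1 _)) (hb0 j)
    linarith
  have hη : ∑ j ∈ Finset.range (n + 1), |g (R * (j / n)) - c j| * b j < η := by
    have : ∑ j ∈ Finset.range (n + 1), η * b j = η := by rw [← Finset.mul_sum, hb1, mul_one]
    rw [← this]
    obtain ⟨j, hj, hbj⟩ : ∃ j ∈ Finset.range (n + 1), 0 < b j := by
      by_contra! h
      have := Finset.sum_nonpos h
      linarith
    exact Finset.sum_lt_sum (fun i _ => mul_le_mul_of_nonneg_right (hc i).le (hb0 i))
      ⟨j, hj, mul_lt_mul_of_pos_right (hc j) hbj⟩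
  change |g (R * t) - ∑ j ∈ Finset.range (n + 1), c j * b j| < _
  calc _ ≤ ∑ j ∈ Finset.range (n + 1),
        (R * L * (|t - j / n| * b j) + |g (R * (j / n)) - c j| * b j) := by
        rw [hsplit]
        exact (Finset.abs_sum_le_sum_abs _ _).trans (Finset.sum_le_sum fun j _ => hterm j)
    _ < R * L * (1 / (2 * N)) + η := by
        rw [Finset.sum_add_distrib, ← Finset.mul_sum]
        exact add_lt_add_of_le_of_lt
          (mul_le_mul_of_nonneg_left hmoment (mul_nonneg hR hL0)) hη
    _ = _ := by ring

namespace PolyCode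

/-- The code of `(x₁² + x₂²) / R`. -/
def sqNormDiv (R : ℕ) : PolyCode :=
  [(RatCode.ofFrac 1 R, (2, 0)), (RatCode.ofFrac 1 R, (0, 2))]

/-- The code of `1 - (x₁² + x₂²) / R`. -/
def oneSubSqNormDiv (R : ℕ) : PolyCode :=
  (RatCode.ofFrac 1 1, (0, 0)) :: [(RatCode.neg (RatCode.ofFrac 1 R), (2, 0)),
    (RatCode.neg (RatCode.ofFrac 1 R), (0, 2))]

theorem eval_sqNormDiv {R : ℕ} (hR : R ≠ 0) (x : Plane) :
    eval (sqNormDiv R) x = (x 0 ^ 2 + x 1 ^ 2) / R := by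
  simp only [sqNormDiv, eval_cons, eval_nil, RatCode.val_ofFrac hR]
  push_cast
  ring

theorem eval_oneSubSqNormDiv {R : ℕ} (hR : R ≠ 0) (x : Plane) :
    eval (oneSubSqNormDiv R) x = 1 - (x 0 ^ 2 + x 1 ^ 2) / R := by
  simp only [oneSubSqNormDiv, eval_cons, eval_nil, RatCode.val_ofFrac hR, RatCode.val_neg,
    RatCode.val_ofFrac one_ne_zero]
  push_cast
  ring

theorem primrec_sqNormDiv : Primrec sqNormDiv := by
  have h : Primrec fun R => RatCode.ofFrac 1 R :=
    RatCode.primrec_ofFrac.comp (Primrec.const 1) Primrec.id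
  exact Primrec.list_cons.comp (h.pair (Primrec.const _))
    (Primrec.list_cons.comp (h.pair (Primrec.const _)) (Primrec.const []))

theorem primrec_oneSubSqNormDiv : Primrec oneSubSqNormDiv := by
  have h : Primrec fun R => RatCode.neg (RatCode.ofFrac 1 R) :=
    RatCode.primrec_neg.comp (RatCode.primrec_ofFrac.comp (Primrec.const 1) Primrec.id)
  exact Primrec.list_cons.comp (Primrec.const _) (Primrec.list_cons.comp (h.pair (Primrec.const _))
    (Primrec.list_cons.comp (h.pair (Primrec.const _)) (Primrec.const [])))

/-- The code of the `j`-th Bernstein polynomial of degree `n` in `(x₁² + x₂²) / R`, with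
coefficient `c`. The binomial coefficient is correct for `j ≤ n`. -/
def bernsteinTerm (R n j : ℕ) (c : RatCode) : PolyCode :=
  mul [(RatCode.mul c
      (RatCode.ofFrac (n.factorial / (j.factorial * (n - j).factorial)) 1), (0, 0))]
    (mul (pow (sqNormDiv R) j) (pow (oneSubSqNormDiv R) (n - j)))

theorem eval_bernsteinTerm {R n j : ℕ} (hR : R ≠ 0) (hj : j ≤ n) (c : RatCode) (x : Plane) :
    eval (bernsteinTerm R n j c) x = (c.val : ℝ) * (n.choose j *
      ((x 0 ^ 2 + x 1 ^ 2) / R) ^ j * (1 - (x 0 ^ 2 + x 1 ^ 2) / R) ^ (n - j)) := by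
  simp only [bernsteinTerm, eval_mul, eval_pow, eval_cons, eval_nil, eval_sqNormDiv hR,
    eval_oneSubSqNormDiv hR, RatCode.val_mul, RatCode.val_ofFrac one_ne_zero,
    ← Nat.choose_eq_factorial_div_factorial hj]
  push_cast
  ring

theorem computable_bernsteinTerm {α : Type*} [Primcodable α] {R n j : α → ℕ} {c : α → RatCode}
    (hR : Computable R) (hn : Computable n) (hj : Computable j) (hc : Computable c) :
    Computable fun a => bernsteinTerm (R a) (n a) (j a) (c a) := by
  have hnj : Computable fun a => n a - j a := Primrec.nat_sub.to_comp.comp hn hj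
  have fac := Primrec.nat_factorial.to_comp
  have hch : Computable fun a =>
      (n a).factorial / ((j a).factorial * (n a - j a).factorial) :=
    Primrec.nat_div.to_comp.comp (fac.comp hn)
      (Primrec.nat_mul.to_comp.comp (fac.comp hj) (fac.comp hnj))
  have hhead : Computable fun a => (RatCode.mul (c a) (RatCode.ofFrac
      ((n a).factorial / ((j a).factorial * (n a - j a).factorial)) 1), ((0, 0) : ℕ × ℕ)) :=
    (RatCode.primrec_mul.to_comp.comp hc
      (RatCode.primrec_ofFrac.to_comp.comp hch (Computable.const 1))).pair (Computable.const (0, 0))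
  exact primrec_mul.to_comp.comp
    (Primrec.list_cons.to_comp.comp hhead (Computable.const []))
    (primrec_mul.to_comp.comp (primrec_pow.to_comp.comp (primrec_sqNormDiv.to_comp.comp hR) hj)
      (primrec_pow.to_comp.comp (primrec_oneSubSqNormDiv.to_comp.comp hR) hnj))

end PolyCode

/-- The composition of a computable Lipschitz function with `x₁² + x₂²` has computable polynomial
approximations, of precision `2 ^ (-m)` on the disk of radius `2 ^ l`. The Lipschitz constant is
used as a finite piece of information that needs no algorithm. -/
theorem IsComputableOnRat.exists_polyCode {g : ℝ → ℝ} (hg : IsComputableOnRat g) {L : ℕ}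
    (hL : ∀ x y, |g x - g y| ≤ L * |x - y|) :
    ∃ B : ℕ × ℕ → PolyCode, Computable B ∧ ∀ (m l : ℕ) (x : Plane), ‖x‖ ≤ 2 ^ l →
      |g (x 0 ^ 2 + x 1 ^ 2) - (B (m, l)).eval x| < (1 / 2 : ℝ) ^ m := by
  obtain ⟨F, hF, hFg⟩ := hg
  -- With `R = 4 ^ l` and degree `N ^ 2`, the Bernstein error is at most `R (L + 1) / (2 N)`, which is
  -- `2 ^ (-m - 1)`; the other half of the precision is left to the coefficients. The summand in
  -- `L + 1` keeps `N` positive.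
  let R : ℕ × ℕ → ℕ := fun a => 4 ^ a.2
  let N : ℕ × ℕ → ℕ := fun a => R a * (L + 1) * 2 ^ a.1
  let n : ℕ × ℕ → ℕ := fun a => N a ^ 2
  have cR : Computable R :=
    Primrec.nat_pow.to_comp.comp (Computable.const 4) Computable.snd
  have cn : Computable n := Primrec.nat_pow.to_comp.comp
    (Primrec.nat_mul.to_comp.comp (Primrec.nat_mul.to_comp.comp cR (Computable.const _))
      (Primrec.nat_pow.to_comp.comp (Computable.const 2) Computable.fst)) (Computable.const 2)
  refine ⟨fun a => PolyCode.sum (fun j => PolyCode.bernsteinTerm (R a) (n a) j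
    (F (RatCode.ofFrac (R a * j) (n a), a.1 + 1))) (n a + 1), ?_, ?_⟩
  · refine PolyCode.computable_sum (P := fun a j => PolyCode.bernsteinTerm (R a) (n a) j
      (F (RatCode.ofFrac (R a * j) (n a), a.1 + 1))) ?_ (Primrec.succ.to_comp.comp cn)
    exact PolyCode.computable_bernsteinTerm (cR.comp Computable.fst) (cn.comp Computable.fst)
      Computable.snd (hF.comp ((RatCode.primrec_ofFrac.to_comp.comp
        (Primrec.nat_mul.to_comp.comp (cR.comp Computable.fst) Computable.snd)
        (cn.comp Computable.fst)).pair
        (Primrec.succ.to_comp.comp (Computable.fst.comp Computable.fst))))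
  · intro m l x hx
    have hR0 : R (m, l) ≠ 0 := by positivity
    have hN0 : N (m, l) ≠ 0 := by positivity
    have hn0 : n (m, l) ≠ 0 := by positivity
    have hRpos : (0 : ℝ) < R (m, l) := Nat.cast_pos.2 (Nat.pos_of_ne_zero hR0)
    have hL' : ∀ x y, |g x - g y| ≤ ((L + 1 : ℕ) : ℝ) * |x - y| := fun x y =>
      (hL x y).trans (mul_le_mul_of_nonneg_right (by push_cast; linarith) (abs_nonneg _))
    have hc : ∀ j : ℕ, |g (R (m, l) * (j / ((N (m, l)) ^ 2 : ℕ))) -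
        ((F (RatCode.ofFrac (R (m, l) * j) (n (m, l)), m + 1)).val : ℝ)| <
          (1 / 2 : ℝ) ^ (m + 1) := fun j => by
      have := hFg (RatCode.ofFrac (R (m, l) * j) (n (m, l))) (m + 1)
      rw [RatCode.val_ofFrac hn0] at this
      push_cast at this
      rw [mul_div_assoc] at this
      exact_mod_cast this
    have ht : (x 0 ^ 2 + x 1 ^ 2) / R (m, l) ∈ Icc (0 : ℝ) 1 := by
      refine ⟨by positivity, (div_le_one hRpos).2 ?_⟩
      rw [sq_add_sq_eq_norm_sq]
      calc ‖x‖ ^ 2 ≤ (2 ^ l) ^ 2 := by gcongr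
        _ = ((R (m, l) : ℕ) : ℝ) := by
          simp only [R]
          push_cast
          rw [← pow_mul, mul_comm, pow_mul]
          norm_num
    have key := abs_sub_bernstein_lt hL' (by positivity) hRpos.le hN0 hc ht
    rw [mul_div_cancel₀ _ hRpos.ne'] at key
    have hval : (R (m, l) : ℝ) * ((L + 1 : ℕ) : ℝ) / (2 * N (m, l)) + (1 / 2 : ℝ) ^ (m + 1) =
        (1 / 2 : ℝ) ^ m := by
      have h3 : (N (m, l) : ℝ) = R (m, l) * ((L + 1 : ℕ) : ℝ) * 2 ^ m := by
        simp only [N]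
        push_cast
        ring
      rw [h3, pow_succ, one_div, inv_pow]
      have : (((L + 1 : ℕ) : ℝ)) ≠ 0 := by positivity
      field_simp
      norm_num
    rw [hval] at key
    rw [PolyCode.eval_sum]
    refine lt_of_eq_of_lt ?_ key
    congr 2
    refine Finset.sum_congr rfl fun j hj => ?_
    exact PolyCode.eval_bernsteinTerm hR0 (Nat.lt_succ_iff.1 (Finset.mem_range.1 hj)) _ _

/-- A Lipschitz profile with computable values at rational points has a computable field. The
factors `x₁` and `x₂` are at most `2 ^ l`, so `l` extra bits of precision are asked of the
profile. -/
theorem IsComputableOnRat.isComputableField {g : ℝ → ℝ} (hg : IsComputableOnRat g) {L : ℕ}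
    (hL : ∀ x y, |g x - g y| ≤ L * |x - y|) {D : Set Plane} (v : C(D, Plane))
    (hv : ∀ x, v x = radialField g x) : IsComputableField v := by
  obtain ⟨B, hB, hBg⟩ := hg.exists_polyCode hL
  have hB' : Computable fun a : ℕ × ℕ => B (a.1 + a.2, a.2) :=
    hB.comp ((Primrec.nat_add.to_comp.comp Computable.fst Computable.snd).pair Computable.snd)
  have happ := fun (Q S : PolyCode) =>
    show Computable fun a : ℕ × ℕ => PolyCode.mul Q (B (a.1 + a.2, a.2)) ++ S from Primrec.list_append.to_comp.comp
    (PolyCode.primrec_mul.to_comp.comp (Computable.const Q) hB') (Computable.const S)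
  refine ⟨fun a =>
    (PolyCode.mul [(RatCode.ofFrac 1 1, (1, 0))] (B (a.1 + a.2, a.2)) ++
      [(RatCode.neg (RatCode.ofFrac 1 1), (0, 1))],
    PolyCode.mul [(RatCode.ofFrac 1 1, (0, 1))] (B (a.1 + a.2, a.2)) ++
      [(RatCode.ofFrac 1 1, (1, 0))]), (happ _ _).pair (happ _ _), fun k l x hx => ?_⟩
  have key := hBg (k + l) l x hx
  have hcoord : ∀ i, |(x : Plane) i| ≤ 2 ^ l := fun i =>
    (PiLp.norm_apply_le (x : Plane) i).trans hx
  have main : ∀ i, |(x : Plane) i * (g ((x : Plane) 0 ^ 2 + (x : Plane) 1 ^ 2) -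
      (B (k + l, l)).eval x)| < (1 / 2 : ℝ) ^ k := fun i => by
    rw [abs_mul]
    calc _ ≤ 2 ^ l * |g ((x : Plane) 0 ^ 2 + (x : Plane) 1 ^ 2) - (B (k + l, l)).eval x| :=
          mul_le_mul_of_nonneg_right (hcoord i) (abs_nonneg _)
      _ < 2 ^ l * (1 / 2 : ℝ) ^ (k + l) := by gcongr
      _ = (1 / 2 : ℝ) ^ k := by
          rw [pow_add, mul_left_comm, ← mul_pow]
          norm_num
  rw [hv]
  simp only [PolyCode.eval_append, PolyCode.eval_mul, PolyCode.eval_cons, PolyCode.eval_nil,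
    RatCode.val_neg, RatCode.val_ofFrac one_ne_zero, radialField]
  constructor
  · convert! main 0 using 2
    simp
    ring
  · convert! main 1 using 2
    simp
    ring

/-! ### The flat function `exp (-1 / x)` -/

namespace expNegInvGlue

open Polynomial

theorem le_one (x : ℝ) : expNegInvGlue x ≤ 1 := by
  unfold expNegInvGlue
  split_ifs with h
  · exact zero_le_one
  · exact Real.exp_le_one_iff.2 (neg_nonpos.2 (inv_nonneg.2 (not_le.1 h).le))

/-- The functions `p (1 / x) exp (-1 / x)`, among which are all derivatives of `exp (-1 / x)`,
are bounded. -/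
theorem exists_bound_polynomial_eval_inv_mul (p : ℝ[X]) :
    ∃ C : ℝ, 0 ≤ C ∧ ∀ x : ℝ, |p.eval x⁻¹ * expNegInvGlue x| ≤ C := by
  obtain ⟨C₁, h₁⟩ := isCompact_Icc.exists_bound_of_continuousOn (s := Icc (0 : ℝ) 1)
    (continuous_polynomial_eval_inv_mul p).continuousOn
  obtain ⟨C₂, h₂⟩ := isCompact_Icc.exists_bound_of_continuousOn (s := Icc (0 : ℝ) 1)
    p.continuous.continuousOn
  have hC₁ : 0 ≤ C₁ := (norm_nonneg _).trans (h₁ 0 (by simp))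
  refine ⟨max C₁ C₂, le_max_of_le_left hC₁, fun x => ?_⟩
  rcases le_or_gt x 0 with hx | hx
  · rw [zero_of_nonpos hx, mul_zero, abs_zero]
    exact le_max_of_le_left hC₁
  rcases le_or_gt x 1 with hx1 | hx1
  · exact le_max_of_le_left (h₁ x ⟨hx.le, hx1⟩)
  · refine le_max_of_le_right ?_
    rw [abs_mul, abs_of_nonneg (nonneg x)]
    refine (mul_le_of_le_one_right (abs_nonneg _) (le_one x)).trans (h₂ x⁻¹ ⟨by positivity, ?_⟩)
    exact inv_le_one_of_one_le₀ hx1.le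

theorem exists_lipschitz_bound :
    ∃ C : ℕ, ∀ x y : ℝ, |expNegInvGlue x - expNegInvGlue y| ≤ C * |x - y| := by
  obtain ⟨C, -, hC⟩ := exists_bound_polynomial_eval_inv_mul (X ^ 2 * (1 - derivative (R := ℝ) 1))
  obtain ⟨n, hn⟩ := exists_nat_ge C
  refine ⟨n, fun x y => ?_⟩
  refine convex_univ.norm_image_sub_le_of_norm_hasDerivWithin_le
    (f := expNegInvGlue)
    (f' := fun z => (X ^ 2 * (1 - derivative (R := ℝ) 1)).eval z⁻¹ * expNegInvGlue z) (fun z _ => ?_) (fun z _ => (hC z).trans hn) (mem_univ y) (mem_univ x)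
  have h := (hasDerivAt_polynomial_eval_inv_mul 1 z).hasDerivWithinAt (s := univ)
  simp only [eval_one, one_mul] at h
  exact h

/-- The elementary bounds `1 + s ≤ exp s` at `s = 1 / (n u)` and at `s = -1 / (n u + 1)`. -/
theorem le_pow_and_pow_le {u : ℝ} (hu : 0 < u) {n : ℕ} (hn : n ≠ 0) :
    expNegInvGlue u ≤ (n * u / (n * u + 1)) ^ n ∧
      (n * u / (n * u + 1)) ^ n ≤ expNegInvGlue (u + 1 / n) := by
  have hn' : (0 : ℝ) < n := Nat.cast_pos.2 (Nat.pos_of_ne_zero hn)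
  have hnu : 0 < n * u := mul_pos hn' hu
  have hu' : 0 < u + 1 / n := by positivity
  have r0 : 0 ≤ n * u / (n * u + 1) := by positivity
  unfold expNegInvGlue
  rw [if_neg (not_le.2 hu), if_neg (not_le.2 hu')]
  constructor
  · have h1 : Real.exp (-u⁻¹) = Real.exp (-(1 / (n * u))) ^ n := by
      rw [← Real.exp_nat_mul]
      congr 1
      field_simp
    rw [h1]
    refine pow_le_pow_left₀ (Real.exp_pos _).le ?_ n
    rw [Real.exp_neg, inv_le_comm₀ (Real.exp_pos _) (by positivity), inv_div]
    refine le_trans (le_of_eq ?_) (Real.add_one_le_exp _)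
    field_simp
    ring
  · have h1 : Real.exp (-(u + 1 / n)⁻¹) = Real.exp (-(1 / (n * u + 1))) ^ n := by
      rw [← Real.exp_nat_mul]
      congr 1
      field_simp
    rw [h1]
    refine pow_le_pow_left₀ r0 ?_ n
    refine le_trans (le_of_eq ?_) (Real.add_one_le_exp _)
    field_simp
    ring

end expNegInvGlue

/-- The code of `(n q / (n q + 1)) ^ n` if the value `q` of the code is positive, and of `0`
otherwise (truncated subtraction makes the numerator vanish). -/
def RatCode.expApprox (q : RatCode) (n : ℕ) : RatCode :=
  RatCode.ofFrac ((n * (q.1 - q.2.1)) ^ n) ((n * (q.1 - q.2.1) + (q.2.2 + 1)) ^ n)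

theorem RatCode.primrec_expApprox : Primrec₂ RatCode.expApprox := by
  have hd : Primrec fun p : RatCode × ℕ => p.2 * (p.1.1 - p.1.2.1) :=
    Primrec.nat_mul.comp Primrec.snd (Primrec.nat_sub.comp (Primrec.fst.comp Primrec.fst)
      (Primrec.fst.comp (Primrec.snd.comp Primrec.fst)))
  exact RatCode.primrec_ofFrac.comp (Primrec.nat_pow.comp hd Primrec.snd)
    (Primrec.nat_pow.comp (Primrec.nat_add.comp hd (RatCode.primrec_den.comp Primrec.fst))
      Primrec.snd)

theorem isComputableOnRat_expNegInvGlue : IsComputableOnRat expNegInvGlue := by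
  obtain ⟨C, hC⟩ := expNegInvGlue.exists_lipschitz_bound
  refine ⟨fun p => RatCode.expApprox p.1 ((C + 1) * 2 ^ p.2),
    RatCode.primrec_expApprox.to_comp.comp Computable.fst
      (Primrec.nat_mul.to_comp.comp (Computable.const _)
        (Primrec.nat_pow.to_comp.comp (Computable.const 2) Computable.snd)), fun q k => ?_⟩
  set n := (C + 1) * 2 ^ k with hn
  have hn0 : n ≠ 0 := by positivity
  have hc : (0 : ℝ) < (q.2.2 : ℝ) + 1 := by positivity
  have hval : (((RatCode.expApprox q n).val : ℚ) : ℝ) = (((n * (q.1 - q.2.1) : ℕ) : ℝ) /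
      ((n * (q.1 - q.2.1) : ℕ) + ((q.2.2 : ℝ) + 1))) ^ n := by
    rw [RatCode.expApprox, RatCode.val_ofFrac (by positivity)]
    push_cast
    rw [div_pow]
  change |expNegInvGlue (q.val : ℝ) - ((RatCode.expApprox q n).val : ℝ)| < _
  rcases le_or_gt q.1 q.2.1 with h | h
  · have hq : (q.val : ℝ) ≤ 0 := by
      rw [RatCode.val]
      push_cast
      exact div_nonpos_of_nonpos_of_nonneg (sub_nonpos.2 (Nat.cast_le.2 h)) hc.le
    rw [hval, Nat.sub_eq_zero_of_le h, expNegInvGlue.zero_of_nonpos hq]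
    simp [hn0]
  · have hd : (q.val : ℝ) = ((q.1 : ℝ) - q.2.1) / ((q.2.2 : ℝ) + 1) := by
      rw [RatCode.val]
      push_cast
      rfl
    have hq : 0 < (q.val : ℝ) := by
      rw [hd]
      exact div_pos (sub_pos.2 (Nat.cast_lt.2 h)) hc
    have hval' : (((RatCode.expApprox q n).val : ℚ) : ℝ) =
        (n * (q.val : ℝ) / (n * (q.val : ℝ) + 1)) ^ n := by
      rw [hval, hd]
      push_cast [Nat.cast_sub h.le]
      congr 1
      have : (0 : ℝ) ≤ n * ((q.1 : ℝ) - q.2.1) :=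
        mul_nonneg (Nat.cast_nonneg _) (sub_nonneg.2 (Nat.cast_le.2 h.le))
      field_simp
    obtain ⟨h1, h2⟩ := expNegInvGlue.le_pow_and_pow_le hq hn0
    rw [← hval'] at h1 h2
    have h3 := (abs_le.1 (hC (q.val : ℝ) ((q.val : ℝ) + 1 / n))).1
    have hnpos : (0 : ℝ) < n := Nat.cast_pos.2 (Nat.pos_of_ne_zero hn0)
    rw [sub_add_cancel_left, abs_neg, abs_of_pos (by positivity)] at h3
    have h4 : (C : ℝ) * (1 / n) < (1 / 2 : ℝ) ^ k := by
      rw [hn, one_div_pow, mul_one_div, div_lt_div_iff₀ (by positivity) (by positivity)]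
      push_cast
      nlinarith [pow_pos (two_pos : (0 : ℝ) < 2) k]
    rw [abs_lt]
    constructor <;> linarith

/-! ### The radial profile -/

section Profile

open Polynomial

theorem hasSum_half_pow_succ : HasSum (fun s : ℕ => (1 / 2 : ℝ) ^ (s + 1)) 1 := by
  convert! hasSum_geometric_two' (1 : ℝ) using 2 with s
  rw [pow_succ, one_div_pow]
  ring

/-- The series of the functions `p (1 / u) exp (-1 / u)` at `u = a s - w`, with weights
`2 ^ (-s - 1)`. -/
noncomputable def flatSeries (a : ℕ → ℝ) (p : ℝ[X]) (w : ℝ) : ℝ :=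
  ∑' s, (1 / 2 : ℝ) ^ (s + 1) * (p.eval (a s - w)⁻¹ * expNegInvGlue (a s - w))

theorem exists_flatSeries_term_bound (a : ℕ → ℝ) (p : ℝ[X]) : ∃ C : ℝ, ∀ (s : ℕ) (w : ℝ),
    ‖(1 / 2 : ℝ) ^ (s + 1) * (p.eval (a s - w)⁻¹ * expNegInvGlue (a s - w))‖ ≤
      C * (1 / 2 : ℝ) ^ (s + 1) := by
  obtain ⟨C, -, hC⟩ := expNegInvGlue.exists_bound_polynomial_eval_inv_mul p
  refine ⟨C, fun s w => ?_⟩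
  rw [norm_mul, mul_comm, Real.norm_of_nonneg (by positivity : (0 : ℝ) ≤ (1 / 2) ^ (s + 1))]
  exact mul_le_mul_of_nonneg_right (hC _) (by positivity)

theorem hasDerivAt_flatSeries (a : ℕ → ℝ) (p : ℝ[X]) (w : ℝ) :
    HasDerivAt (flatSeries a p) (flatSeries a (-(X ^ 2 * (p - derivative p))) w) w := by
  obtain ⟨C, hC⟩ := exists_flatSeries_term_bound a p
  obtain ⟨C', hC'⟩ := exists_flatSeries_term_bound a (-(X ^ 2 * (p - derivative p)))
  refine hasDerivAt_tsum (hasSum_half_pow_succ.summable.mul_left C') (fun s y => ?_) hC'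
    (y₀ := 0) ?_ w
  · have h := (expNegInvGlue.hasDerivAt_polynomial_eval_inv_mul p (a s - y)).comp y
      ((hasDerivAt_id y).const_sub (a s))
    convert! h.const_mul ((1 / 2 : ℝ) ^ (s + 1)) using 1
    simp
  · exact (hasSum_half_pow_succ.summable.mul_left C).of_norm_bounded (fun s => hC s 0)

theorem contDiff_flatSeries (a : ℕ → ℝ) (p : ℝ[X]) : ContDiff ℝ ∞ (flatSeries a p) := by
  refine contDiff_all_iff_nat.2 (fun m => ?_) _
  induction m generalizing p with
  | zero =>
    exact contDiff_zero.2
      (continuous_iff_continuousAt.2 fun w => (hasDerivAt_flatSeries a p w).continuousAt)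
  | succ m ihm =>
    rw [show ((m + 1 : ℕ) : WithTop ℕ∞) = m + 1 from rfl]
    refine contDiff_succ_iff_deriv.2
      ⟨fun w => (hasDerivAt_flatSeries a p w).differentiableAt, by simp, ?_⟩
    convert! ihm (-(X ^ 2 * (p - derivative p))) using 2
    exact funext fun w => (hasDerivAt_flatSeries a p w).deriv

/-- The profile determined by a sequence `a`: nonpositive, negative below some `a s` and above
`4`, and zero between `sup a` and `4`. -/
noncomputable def profile (a : ℕ → ℝ) (w : ℝ) : ℝ := -expNegInvGlue (w - 4) - flatSeries a 1 w

variable {a : ℕ → ℝ}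

theorem flatSeries_one (a : ℕ → ℝ) (w : ℝ) :
    flatSeries a 1 w = ∑' s, (1 / 2 : ℝ) ^ (s + 1) * expNegInvGlue (a s - w) := by
  simp [flatSeries]

theorem summable_flatSeries_one (a : ℕ → ℝ) (w : ℝ) :
    Summable fun s => (1 / 2 : ℝ) ^ (s + 1) * expNegInvGlue (a s - w) :=
  hasSum_half_pow_succ.summable.of_nonneg_of_le
    (fun s => mul_nonneg (by positivity) (expNegInvGlue.nonneg _))
    (fun s => mul_le_of_le_one_right (by positivity) (expNegInvGlue.le_one _))

theorem flatSeries_one_nonneg (a : ℕ → ℝ) (w : ℝ) : 0 ≤ flatSeries a 1 w := by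
  rw [flatSeries_one]
  exact tsum_nonneg fun s => mul_nonneg (by positivity) (expNegInvGlue.nonneg _)

theorem contDiff_profile (a : ℕ → ℝ) : ContDiff ℝ ∞ (profile a) :=
  ((expNegInvGlue.contDiff (n := ⊤)).comp (contDiff_id.sub contDiff_const)).neg.sub
    (contDiff_flatSeries a 1)

theorem profile_nonpos (a : ℕ → ℝ) (w : ℝ) : profile a w ≤ 0 := by
  have := expNegInvGlue.nonneg (w - 4)
  have := flatSeries_one_nonneg a w
  rw [profile]
  linarith

theorem abs_profile_le (a : ℕ → ℝ) (w : ℝ) : |profile a w| ≤ 2 := by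
  rw [abs_of_nonpos (profile_nonpos a w), profile]
  have h1 := expNegInvGlue.le_one (w - 4)
  have h2 : flatSeries a 1 w ≤ 1 := by
    rw [flatSeries_one]
    exact ((summable_flatSeries_one a w).tsum_le_tsum
      (fun s => mul_le_of_le_one_right (by positivity) (expNegInvGlue.le_one _))
      hasSum_half_pow_succ.summable).trans_eq hasSum_half_pow_succ.tsum_eq
  linarith

theorem profile_neg_of_lt {w : ℝ} {s : ℕ} (h : w < a s) : profile a w < 0 := by
  have h1 := expNegInvGlue.nonneg (w - 4)
  have h2 : 0 < flatSeries a 1 w := by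
    rw [flatSeries_one]
    exact (summable_flatSeries_one a w).tsum_pos
      (fun s => mul_nonneg (by positivity) (expNegInvGlue.nonneg _)) s
      (mul_pos (by positivity) (expNegInvGlue.pos_of_pos (sub_pos.2 h)))
  rw [profile]
  linarith

theorem profile_neg_of_four_lt {w : ℝ} (h : 4 < w) : profile a w < 0 := by
  have h1 := expNegInvGlue.pos_of_pos (sub_pos.2 h)
  have h2 := flatSeries_one_nonneg a w
  rw [profile]
  linarith

theorem profile_eq_zero {w : ℝ} (h : ∀ s, a s ≤ w) (hw : w ≤ 4) : profile a w = 0 := by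
  rw [profile, flatSeries_one, expNegInvGlue.zero_of_nonpos (sub_nonpos.2 hw)]
  simp [expNegInvGlue.zero_of_nonpos (sub_nonpos.2 (h _))]

theorem exists_lipschitz_bound_profile (a : ℕ → ℝ) :
    ∃ L : ℕ, ∀ x y, |profile a x - profile a y| ≤ L * |x - y| := by
  obtain ⟨C, hC⟩ := expNegInvGlue.exists_lipschitz_bound
  refine ⟨2 * C, fun x y => ?_⟩
  have h1 := hC (x - 4) (y - 4)
  rw [sub_sub_sub_cancel_right] at h1
  have h2 : |flatSeries a 1 x - flatSeries a 1 y| ≤ C * |x - y| := by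
    rw [flatSeries_one, flatSeries_one,
      ← (summable_flatSeries_one a x).tsum_sub (summable_flatSeries_one a y)]
    refine (Real.norm_eq_abs _).ge.trans <| tsum_of_norm_bounded (g := fun s => C * |x - y| * (1 / 2 : ℝ) ^ (s + 1)) ?_ fun s => ?_
    · simpa using hasSum_half_pow_succ.mul_left (C * |x - y|)
    · have := hC (a s - x) (a s - y)
      rw [sub_sub_sub_cancel_left, abs_sub_comm y x] at this
      rw [← mul_sub, norm_mul, mul_comm,
        Real.norm_of_nonneg (by positivity : (0 : ℝ) ≤ (1 / 2) ^ (s + 1))]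
      exact mul_le_mul_of_nonneg_right this (by positivity)
  have h3 : profile a x - profile a y = -(expNegInvGlue (x - 4) - expNegInvGlue (y - 4)) +
      -(flatSeries a 1 x - flatSeries a 1 y) := by
    rw [profile, profile]
    ring
  rw [h3]
  refine (abs_add_le _ _).trans ?_
  rw [abs_neg, abs_neg]
  push_cast
  linarith

theorem abs_flatSeries_one_sub_sum_le (a : ℕ → ℝ) (w : ℝ) (N : ℕ) :
    |flatSeries a 1 w - ∑ s ∈ Finset.range N, (1 / 2 : ℝ) ^ (s + 1) * expNegInvGlue (a s - w)| ≤
      (1 / 2 : ℝ) ^ N := by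
  rw [flatSeries_one, ← (summable_flatSeries_one a w).sum_add_tsum_nat_add N, add_sub_cancel_left]
  refine (Real.norm_eq_abs _).ge.trans <| tsum_of_norm_bounded (g := fun s => (1 / 2 : ℝ) ^ N * (1 / 2 : ℝ) ^ (s + 1)) ?_ fun s => ?_
  · simpa using hasSum_half_pow_succ.mul_left ((1 / 2 : ℝ) ^ N)
  · rw [Real.norm_of_nonneg (mul_nonneg (by positivity) (expNegInvGlue.nonneg _))]
    refine (mul_le_of_le_one_right (by positivity) (expNegInvGlue.le_one _)).trans (le_of_eq ?_)
    ring

/-- The profile of a computable sequence of rationals is computable at rational points, since the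
tails of the series are controlled by the weights. -/
theorem isComputableOnRat_profile {r : ℕ → RatCode} (hr : Computable r) :
    IsComputableOnRat (profile fun s => ((r s).val : ℝ)) := by
  obtain ⟨F, hF, hFψ⟩ := isComputableOnRat_expNegInvGlue
  have csub : Computable₂ fun x y : RatCode => RatCode.add x (RatCode.neg y) :=
    RatCode.primrec_add.to_comp.comp Computable.fst (RatCode.primrec_neg.to_comp.comp Computable.snd)
  have ck : Computable fun p : RatCode × ℕ => p.2 + 2 :=
    Primrec.nat_add.to_comp.comp Computable.snd (Computable.const 2)
  let T : RatCode × ℕ → ℕ → RatCode := fun p s => RatCode.mul (RatCode.halfPow (s + 1))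
    (F (RatCode.add (r s) (RatCode.neg p.1), p.2 + 2))
  have cT : Computable₂ T :=
    RatCode.primrec_mul.to_comp.comp
      (RatCode.primrec_halfPow.to_comp.comp (Primrec.succ.to_comp.comp Computable.snd))
      (hF.comp ((csub.comp (hr.comp Computable.snd) (Computable.fst.comp Computable.fst)).pair
        (ck.comp Computable.fst)))
  refine ⟨fun p => RatCode.neg (RatCode.add
    (F (RatCode.add p.1 (RatCode.neg (RatCode.ofFrac 4 1)), p.2 + 2))
    (RatCode.sum (T p) (p.2 + 2))), ?_, fun q k => ?_⟩
  · exact RatCode.primrec_neg.to_comp.comp (RatCode.primrec_add.to_comp.comp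
      (hF.comp ((csub.comp Computable.fst (Computable.const _)).pair ck))
      (RatCode.computable_sum cT ck))
  · have h1 := hFψ (RatCode.add q (RatCode.neg (RatCode.ofFrac 4 1))) (k + 2)
    have h2 := abs_flatSeries_one_sub_sum_le (fun s => ((r s).val : ℝ)) (q.val : ℝ) (k + 2)
    have h3 : |∑ s ∈ Finset.range (k + 2),
          (1 / 2 : ℝ) ^ (s + 1) * expNegInvGlue (((r s).val : ℝ) - (q.val : ℝ)) -
        ∑ s ∈ Finset.range (k + 2), ((T (q, k) s).val : ℝ)| ≤ (1 / 2 : ℝ) ^ (k + 2) := by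
      rw [← Finset.sum_sub_distrib]
      calc _ ≤ ∑ s ∈ Finset.range (k + 2), (1 / 2 : ℝ) ^ (k + 2) * (1 / 2 : ℝ) ^ (s + 1) := by
            refine (Finset.abs_sum_le_sum_abs _ _).trans (Finset.sum_le_sum fun s _ => ?_)
            have h := hFψ (RatCode.add (r s) (RatCode.neg q)) (k + 2)
            rw [RatCode.val_add, RatCode.val_neg] at h
            push_cast at h
            rw [← sub_eq_add_neg] at h
            simp only [T, RatCode.val_mul, RatCode.val_halfPow]
            push_cast
            rw [← mul_sub, abs_mul, abs_of_pos (by positivity), mul_comm]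
            exact mul_le_mul_of_nonneg_right h.le (by positivity)
        _ ≤ (1 / 2 : ℝ) ^ (k + 2) := by
            rw [← Finset.mul_sum]
            refine mul_le_of_le_one_right (by positivity) ?_
            exact sum_le_hasSum _ (fun s _ => by positivity) hasSum_half_pow_succ
    rw [RatCode.val_add, RatCode.val_neg, RatCode.val_ofFrac one_ne_zero] at h1
    push_cast at h1
    rw [div_one, ← sub_eq_add_neg] at h1
    rw [RatCode.val_neg, RatCode.val_add, RatCode.val_sum, profile]
    push_cast
    have h4 : (1 / 2 : ℝ) ^ (k + 2) = (1 / 2 : ℝ) ^ k / 4 := by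
      rw [pow_add]
      norm_num
      ring
    have h5 : (0 : ℝ) < (1 / 2 : ℝ) ^ k := by positivity
    rw [h4] at h1 h2 h3
    rw [abs_lt] at h1 ⊢
    rw [abs_le] at h2 h3
    constructor <;> linarith

theorem IsComputableOnRat.comp_sub_const {g : ℝ → ℝ} (hg : IsComputableOnRat g) (δ : ℚ) :
    IsComputableOnRat fun w => g (w - δ) := by
  obtain ⟨F, hF, hFg⟩ := hg
  obtain ⟨c, hc⟩ := RatCode.exists_val_eq (-δ)
  refine ⟨fun p => F (RatCode.add p.1 c, p.2), hF.comp ((RatCode.primrec_add.to_comp.comp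
    Computable.fst (Computable.const c)).pair Computable.snd), fun q k => ?_⟩
  have := hFg (RatCode.add q c) k
  rw [RatCode.val_add, hc] at this
  push_cast at this
  rwa [← sub_eq_add_neg] at this

end Profile

/-! ### A left-computable real that is not right-computable -/

/-- A real number is right-computable if it is the infimum of a computable sequence of rational
upper bounds. -/
def IsRightComputableReal (α : ℝ) : Prop :=
  ∃ u : ℕ → RatCode, Computable u ∧ (∀ m, α ≤ ((u m).val : ℝ)) ∧
    ∀ ε > 0, ∃ m, ((u m).val : ℝ) < α + ε

theorem IsComputableReal.isRightComputableReal {α : ℝ} (h : IsComputableReal α) :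
    IsRightComputableReal α := by
  obtain ⟨r, hr, hrα⟩ := h
  refine ⟨fun m => RatCode.add (r m) (RatCode.halfPow m),
    RatCode.primrec_add.to_comp.comp hr RatCode.primrec_halfPow.to_comp, fun m => ?_,
    fun ε hε => ?_⟩
  · have := (abs_lt.1 (hrα m)).2
    rw [RatCode.val_add, RatCode.val_halfPow]
    push_cast
    linarith
  · obtain ⟨m, hm⟩ := exists_pow_lt_of_lt_one (half_pos hε) (by norm_num : (1 / 2 : ℝ) < 1)
    refine ⟨m, ?_⟩
    have := (abs_lt.1 (hrα m)).1
    rw [RatCode.val_add, RatCode.val_halfPow]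
    push_cast
    linarith

theorem IsRightComputableReal.of_add_ratCast {α : ℝ} {δ : ℚ}
    (h : IsRightComputableReal (α + δ)) : IsRightComputableReal α := by
  obtain ⟨u, hu, hα, hε⟩ := h
  obtain ⟨c, hc⟩ := RatCode.exists_val_eq (-δ)
  have hval : ∀ m, ((RatCode.add (u m) c).val : ℝ) = (u m).val - δ := fun m => by
    rw [RatCode.val_add, hc]
    push_cast
    ring
  refine ⟨fun m => RatCode.add (u m) c,
    RatCode.primrec_add.to_comp.comp hu (Computable.const c), fun m => ?_, fun ε h => ?_⟩
  · rw [hval]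
    linarith [hα m]
  · obtain ⟨m, hm⟩ := hε ε h
    refine ⟨m, ?_⟩
    rw [hval]
    linarith

theorem IsLeftComputableReal.add_ratCast {α : ℝ} (h : IsLeftComputableReal α) (δ : ℚ) :
    IsLeftComputableReal (α + δ) := by
  obtain ⟨r, hr, hmono, hlim⟩ := h
  obtain ⟨c, hc⟩ := RatCode.exists_val_eq δ
  have hval : ∀ m, (RatCode.add (r m) c).val = (r m).val + δ := fun m => by
    rw [RatCode.val_add, hc]
  refine ⟨fun m => RatCode.add (r m) c,
    RatCode.primrec_add.to_comp.comp hr (Computable.const c), fun i j hij => ?_, ?_⟩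
  · simp only [hval]
    exact add_le_add_left (hmono hij) δ
  · simp only [hval]
    push_cast
    exact hlim.add_const _

/-- A dense computable sequence in the complement of the disk `x₁² + x₂² < α` in `D` provides
upper bounds of `α`, which are arbitrarily good if `D` meets the boundary circle. -/
theorem IsCoREOpen.isRightComputableReal {D : Set Plane} {α : ℝ} {p : Plane}
    (h : IsCoREOpen D {x | x 0 ^ 2 + x 1 ^ 2 < α}) (hpD : p ∈ D) (hp : p 0 ^ 2 + p 1 ^ 2 = α) :
    IsRightComputableReal α := by
  have hpW : p ∈ D \ {x | x 0 ^ 2 + x 1 ^ 2 < α} := ⟨hpD, fun h => (show p 0 ^ 2 + p 1 ^ 2 < α from h).ne hp⟩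
  rcases h with h | ⟨x, ⟨r, hr, hrx⟩, hxD, hdense⟩
  · rw [h] at hpW
    exact hpW.elim
  let sq : RatPointCode → RatCode := fun y => RatCode.add (RatCode.mul y.1 y.1)
    (RatCode.mul y.2 y.2)
  have csq : Computable sq := RatCode.primrec_add.to_comp.comp
    (RatCode.primrec_mul.to_comp.comp Computable.fst Computable.fst)
    (RatCode.primrec_mul.to_comp.comp Computable.snd Computable.snd)
  have hsq : ∀ y, ((sq y).val : ℝ) = ‖RatPointCode.val y‖ ^ 2 := fun y => by
    rw [← sq_add_sq_eq_norm_sq]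
    simp only [sq, RatCode.val_add, RatCode.val_mul, RatPointCode.val]
    simp
    ring
  -- A point `y` at distance less than `e = 2 ^ (-k) ≤ 1` from `x j` gives the upper bound
  -- `‖y‖ ² + e (2 ‖y‖ ² + 3)` of `‖x j‖ ²`, as `2 ‖y‖ + e ≤ 2 ‖y‖ ² + 3`.
  let U : ℕ × ℕ → RatCode := fun a => RatCode.add (sq (r a))
    (RatCode.mul (RatCode.halfPow a.2)
      (RatCode.add (RatCode.mul (RatCode.ofFrac 2 1) (sq (r a))) (RatCode.ofFrac 3 1)))
  have cU : Computable U := by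
    have c := csq.comp hr
    exact RatCode.primrec_add.to_comp.comp c (RatCode.primrec_mul.to_comp.comp
      (RatCode.primrec_halfPow.to_comp.comp Computable.snd) (RatCode.primrec_add.to_comp.comp
        (RatCode.primrec_mul.to_comp.comp (Computable.const _) c) (Computable.const _)))
  have hU : ∀ j k, ((U (j, k)).val : ℝ) = ‖RatPointCode.val (r (j, k))‖ ^ 2 +
      (1 / 2 : ℝ) ^ k * (2 * ‖RatPointCode.val (r (j, k))‖ ^ 2 + 3) := fun j k => by
    simp only [U, RatCode.val_add, RatCode.val_mul, RatCode.val_halfPow,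
      RatCode.val_ofFrac one_ne_zero]
    push_cast
    rw [hsq]
    norm_num
  refine ⟨fun m => U m.unpair, cU.comp Primrec.unpair.to_comp, fun m => ?_, fun ε hε => ?_⟩
  · set j := m.unpair.1
    set k := m.unpair.2
    change α ≤ ((U (j, k)).val : ℝ)
    rw [hU]
    have h1 : α ≤ ‖x j‖ ^ 2 := by
      rw [← sq_add_sq_eq_norm_sq]
      exact not_lt.1 (hxD j).2
    have h2 : ‖x j‖ ≤ ‖RatPointCode.val (r (j, k))‖ + (1 / 2 : ℝ) ^ k := by
      have := norm_le_insert' (x j) (RatPointCode.val (r (j, k)))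
      linarith [hrx j k]
    have h3 : (0 : ℝ) < (1 / 2 : ℝ) ^ k := by positivity
    have h4 : (1 / 2 : ℝ) ^ k ≤ 1 := pow_le_one₀ (by norm_num) (by norm_num)
    have h5 := pow_le_pow_left₀ (norm_nonneg _) h2 2
    set z := ‖RatPointCode.val (r (j, k))‖
    set e := (1 / 2 : ℝ) ^ k
    nlinarith [mul_nonneg h3.le (sq_nonneg (z - 1)), mul_nonneg h3.le (sub_nonneg.2 h4),
      mul_nonneg h3.le (sq_nonneg z)]
  · have hopen : IsOpen {y : Plane | ‖y‖ ^ 2 < α + ε} :=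
      isOpen_lt (by fun_prop) continuous_const
    obtain ⟨_, hj, ⟨j, rfl⟩⟩ := mem_closure_iff.1 (hdense hpW) _ hopen (by
      rw [mem_ofPred_eq, ← sq_add_sq_eq_norm_sq, hp]
      linarith)
    have hpow : Tendsto (fun k : ℕ => (1 / 2 : ℝ) ^ k) atTop (𝓝 0) :=
      tendsto_pow_atTop_nhds_zero_of_lt_one (by norm_num) (by norm_num)
    have hy : Tendsto (fun k => RatPointCode.val (r (j, k))) atTop (𝓝 (x j)) := by
      rw [tendsto_iff_norm_sub_tendsto_zero]
      refine squeeze_zero (fun _ => norm_nonneg _) (fun k => ?_) hpow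
      rw [norm_sub_rev]
      exact (hrx j k).le
    have hn := hy.norm.pow 2
    have hlim : Tendsto (fun k => ((U (j, k)).val : ℝ)) atTop (𝓝 (‖x j‖ ^ 2)) := by
      simp only [hU]
      simpa using hn.add (hpow.mul ((hn.const_mul 2).add_const 3))
    obtain ⟨k, hk⟩ := (hlim.eventually_lt_const hj).exists
    exact ⟨Nat.pair j k, by simpa using hk⟩

namespace Specker

open Nat.Partrec

/-- Whether the `n`-th program, started on input `0`, is seen to halt before stage `s`, where only
the first `s` programs are inspected at stage `s`. -/
def haltsBy (s n : ℕ) : Bool :=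
  decide (n < s) && (Code.evaln s (Denumerable.ofNat Code n) 0).isSome

theorem haltsBy_mono {s t n : ℕ} (hst : s ≤ t) (h : haltsBy s n = true) : haltsBy t n = true := by
  simp only [haltsBy, Bool.and_eq_true, decide_eq_true_eq, Option.isSome_iff_exists] at h ⊢
  obtain ⟨h1, y, hy⟩ := h
  exact ⟨h1.trans_le hst, y, Code.evaln_mono hst hy⟩

theorem exists_haltsBy_iff (n : ℕ) :
    (∃ s, haltsBy s n = true) ↔ ((Denumerable.ofNat Code n).eval 0).Dom := by
  simp only [haltsBy, Bool.and_eq_true, decide_eq_true_eq, Option.isSome_iff_exists]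
  constructor
  · rintro ⟨s, -, y, hy⟩
    exact Part.dom_iff_mem.2 ⟨y, Code.evaln_sound hy⟩
  · intro h
    obtain ⟨y, hy⟩ := Part.dom_iff_mem.1 h
    obtain ⟨s, hs⟩ := Code.evaln_complete.1 hy
    exact ⟨max s (n + 1), by omega, y, Code.evaln_mono (le_max_left _ _) hs⟩

theorem primrec_haltsBy : Primrec₂ haltsBy :=
  Primrec.and.comp (PrimrecPred.decide (Primrec.nat_lt.comp Primrec.snd Primrec.fst))
    (Primrec.option_isSome.comp (Code.primrec_evaln.comp
      ((Primrec.fst.pair ((Primrec.ofNat Code).comp Primrec.snd)).pair (Primrec.const 0))))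

/-- The contribution of the `n`-th program to the `s`-th approximation. -/
def term (s n : ℕ) : RatCode := bif haltsBy s n then RatCode.halfPow (n + 1) else (0, 0, 0)

theorem val_term (s n : ℕ) :
    ((term s n).val : ℝ) = if haltsBy s n = true then (1 / 2 : ℝ) ^ (n + 1) else 0 := by
  unfold term
  cases haltsBy s n
  · simp [RatCode.val]
  · simp [RatCode.val_halfPow]

/-- The approximation `1 + ∑ 2 ^ (-n - 1)`, the sum being over the programs `n` that are seen to
halt before stage `s`. -/
def approx (s : ℕ) : RatCode := RatCode.add (RatCode.ofFrac 1 1) (RatCode.sum (term s) s)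

theorem computable_approx : Computable approx := by
  have ht : Computable₂ term := Computable.cond primrec_haltsBy.to_comp
    (RatCode.primrec_halfPow.to_comp.comp (Primrec.succ.to_comp.comp Computable.snd))
    (Computable.const _)
  exact RatCode.primrec_add.to_comp.comp (Computable.const _)
    (RatCode.computable_sum ht Computable.id)

/-- The sum may be extended beyond the stage, since uninspected programs contribute nothing. This
makes approximations at different stages comparable term by term. -/
theorem val_approx {s t : ℕ} (hst : s ≤ t) :
    ((approx s).val : ℝ) = 1 + ∑ n ∈ Finset.range t, ((term s n).val : ℝ) := by
  rw [approx, RatCode.val_add, RatCode.val_sum, RatCode.val_ofFrac one_ne_zero]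
  push_cast
  rw [div_one]
  congr 1
  refine Finset.sum_subset (Finset.range_mono hst) fun n _ hn => ?_
  rw [val_term, if_neg]
  have : ¬ n < s := by simpa using hn
  simp [haltsBy, this]

theorem val_term_le {s t : ℕ} (hst : s ≤ t) (n : ℕ) :
    ((term s n).val : ℝ) ≤ ((term t n).val : ℝ) := by
  rw [val_term, val_term]
  split_ifs with h1 h2 h2
  · exact le_rfl
  · exact absurd (haltsBy_mono hst h1) h2
  · positivity
  · exact le_rfl

theorem monotone_approx : Monotone fun s => ((approx s).val : ℝ) := fun s t hst => by
  simp only [val_approx hst, val_approx le_rfl]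
  exact add_le_add_right (Finset.sum_le_sum fun n _ => val_term_le hst n) _

theorem one_le_approx (s : ℕ) : 1 ≤ ((approx s).val : ℝ) := by
  rw [val_approx le_rfl, le_add_iff_nonneg_right]
  refine Finset.sum_nonneg fun n _ => ?_
  rw [val_term]
  positivity

theorem approx_le_two (s : ℕ) : ((approx s).val : ℝ) ≤ 2 := by
  have h : ∑ n ∈ Finset.range s, ((term s n).val : ℝ) ≤ 1 := by
    refine (Finset.sum_le_sum fun n _ => ?_).trans
      (sum_le_hasSum (Finset.range s) (fun n _ => by positivity) hasSum_half_pow_succ)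
    rw [val_term]
    split_ifs
    · exact le_rfl
    · positivity
  rw [val_approx le_rfl]
  linarith

/-- A Specker number: the binary expansion of `limit - 1` encodes the halting problem. -/
noncomputable def limit : ℝ := ⨆ s, ((approx s).val : ℝ)

theorem bddAbove_approx : BddAbove (range fun s => ((approx s).val : ℝ)) :=
  ⟨2, forall_mem_range.2 approx_le_two⟩

theorem tendsto_approx : Tendsto (fun s => ((approx s).val : ℝ)) atTop (𝓝 limit) :=
  tendsto_atTop_ciSup monotone_approx bddAbove_approx

theorem approx_le_limit (s : ℕ) : ((approx s).val : ℝ) ≤ limit := le_ciSup bddAbove_approx s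

theorem one_le_limit : 1 ≤ limit := (one_le_approx 0).trans (approx_le_limit 0)

theorem limit_le_two : limit ≤ 2 := ciSup_le approx_le_two

theorem isLeftComputableReal_limit : IsLeftComputableReal limit :=
  ⟨approx, computable_approx, fun _ _ h => Rat.cast_le.1 (monotone_approx h), tendsto_approx⟩

/-- A program that halts, but was not seen to halt before stage `s`, will add `2 ^ (-n - 1)` to the
`s`-th approximation. -/
theorem approx_add_le_limit {s n : ℕ} (hs : haltsBy s n = false) (hn : ∃ t, haltsBy t n = true) :
    ((approx s).val : ℝ) + (1 / 2 : ℝ) ^ (n + 1) ≤ limit := by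
  obtain ⟨t₀, ht₀⟩ := hn
  set t := max (max s t₀) (n + 1)
  have hst : s ≤ t := (le_max_left _ _).trans (le_max_left _ _)
  have ht : haltsBy t n = true := haltsBy_mono ((le_max_right _ _).trans (le_max_left _ _)) ht₀
  have hnt : n ∈ Finset.range t := Finset.mem_range.2 (Nat.lt_of_succ_le (le_max_right _ _))
  refine le_trans ?_ (approx_le_limit t)
  have h := Finset.single_le_sum
    (f := fun n => ((term t n).val : ℝ) - ((term s n).val : ℝ))
    (fun n _ => sub_nonneg.2 (val_term_le hst n)) hnt
  rw [Finset.sum_sub_distrib] at h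
  simp only [val_term t n, val_term s n, ht, hs] at h
  rw [val_approx hst, val_approx le_rfl]
  simp at h ⊢
  linarith

theorem not_isRightComputableReal_limit : ¬ IsRightComputableReal limit := by
  rintro ⟨u, hu, hle, hlim⟩
  refine ComputablePred.halting_problem 0 (ComputablePred.computable_iff_re_compl_re'.2
    ⟨ComputablePred.halting_problem_re 0, ?_⟩)
  -- The `n`-th program does not halt iff, at some stage at which it is not seen to halt, an upper
  -- bound of the limit exceeds the approximation by less than `2 ^ (-n - 1)`.
  let bound : Code → ℕ → RatCode := fun c m =>
    RatCode.add (approx m.unpair.2) (RatCode.halfPow (Encodable.encode c + 1))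
  let test : Code → ℕ → Bool := fun c m =>
    decide ((u m.unpair.1).val < (bound c m).val) && !haltsBy m.unpair.2 (Encodable.encode c)
  have cenc : Computable fun a : Code × ℕ => Encodable.encode a.1 :=
    Computable.encode.comp Computable.fst
  have c₂ : Computable fun a : Code × ℕ => a.2.unpair.2 :=
    Computable.snd.comp (Primrec.unpair.to_comp.comp Computable.snd)
  have cbound : Computable₂ bound := RatCode.primrec_add.to_comp.comp (computable_approx.comp c₂)
    (RatCode.primrec_halfPow.to_comp.comp (Primrec.succ.to_comp.comp cenc))
  have cu : Computable fun a : Code × ℕ => u a.2.unpair.1 :=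
    hu.comp (Computable.fst.comp (Primrec.unpair.to_comp.comp Computable.snd))
  have clt : Computable₂ fun x y : RatCode => decide (x.val < y.val) :=
    (PrimrecPred.decide RatCode.primrecRel_val_lt).to_comp
  have ctest : Computable₂ test := Primrec.and.to_comp.comp (clt.comp cu cbound)
    (Primrec.not.to_comp.comp (primrec_haltsBy.to_comp.comp c₂ cenc))
  refine (Partrec.rfind (p := fun c m => Part.some (test c m)) ctest.partrec₂).dom_re.of_eq
    fun c => ?_
  have hhalt : (∃ s, haltsBy s (Encodable.encode c) = true) ↔ (c.eval 0).Dom := by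
    rw [exists_haltsBy_iff, Denumerable.ofNat_encode]
  have hdom : (Nat.rfind fun m => Part.some (test c m)).Dom ↔ ∃ m, test c m = true := by
    refine Nat.rfind_dom.trans ?_
    exact ⟨fun ⟨m, h, _⟩ => ⟨m, (Part.mem_some_iff.1 h).symm⟩,
      fun ⟨m, h⟩ => ⟨m, Part.mem_some_iff.2 h.symm, fun _ => trivial⟩⟩
  have hbound : ∀ m, ((bound c m).val : ℝ) =
      (approx m.unpair.2).val + (1 / 2 : ℝ) ^ (Encodable.encode c + 1) := fun m => by
    simp only [bound, RatCode.val_add, RatCode.val_halfPow]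
    push_cast
    rfl
  rw [hdom, ← hhalt]
  constructor
  · rintro ⟨m, hm⟩ h
    simp only [test, Bool.and_eq_true, decide_eq_true_eq, Bool.not_eq_true'] at hm
    have h1 := approx_add_le_limit hm.2 h
    have h2 := Rat.cast_lt (K := ℝ).2 hm.1
    rw [hbound] at h2
    linarith [hle m.unpair.1]
  · intro h
    have hε : (0 : ℝ) < (1 / 2 : ℝ) ^ (Encodable.encode c + 1) / 2 := by positivity
    obtain ⟨i, hi⟩ := hlim _ hε
    obtain ⟨s, hs⟩ := (tendsto_approx.eventually_const_lt (sub_lt_self _ hε)).exists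
    refine ⟨Nat.pair i s, ?_⟩
    simp only [test, Bool.and_eq_true, decide_eq_true_eq, Bool.not_eq_true', Nat.unpair_pair]
    refine ⟨Rat.cast_lt (K := ℝ).1 ?_, Bool.eq_false_iff.2 fun h' => h ⟨s, h'⟩⟩
    rw [hbound, Nat.unpair_pair]
    linarith

end Specker

/-! ### Global solutions of a vector field of linear growth -/

/-- A `C¹` field of linear growth has global solutions: the Picard-Lindelöf theorem on the ball of
radius `‖x‖ + 1` around `x` gives a time of existence that does not depend on `x`. -/
theorem exists_forall_hasDerivAt_of_norm_le {E : Type*} [NormedAddCommGroup E] [NormedSpace ℝ E]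
    [FiniteDimensional ℝ E] {v : E → E} (hv : ContDiff ℝ 1 v) {C : ℝ} (hC : 0 < C)
    (hvC : ∀ x, ‖v x‖ ≤ C * ‖x‖) (x : E) :
    ∃ φ : ℝ → E, φ 0 = x ∧ ∀ t, HasDerivAt φ (v (φ t)) t := by
  have : CompleteSpace E := FiniteDimensional.complete ℝ E
  have : ProperSpace E := FiniteDimensional.proper ℝ E
  set ε : ℝ := 1 / (2 * C) with hε
  have hε0 : 0 < ε := by positivity
  obtain ⟨φ, h0, hφ⟩ := exists_isMIntegralCurve_of_isMIntegralCurveOn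
    (I := modelWithCornersSelf ℝ E) (v := v) (contMDiff_vectorSpace_iff_contDiff.2 hv) hε0
    (fun y => by
      obtain ⟨K, hK⟩ := LocallyLipschitzOn.exists_lipschitzOnWith_of_compact
        (isCompact_closedBall y (‖y‖ + 1)) hv.locallyLipschitz.locallyLipschitzOn
      have hPL : IsPicardLindelof (fun _ => v) (tmin := -ε) (tmax := ε)
          ⟨0, by constructor <;> linarith⟩ y (‖y‖₊ + 1) 0 (C.toNNReal * (2 * ‖y‖₊ + 1)) K := by
        refine ⟨fun _ _ => hK, fun z _ => continuousOn_const, fun _ _ z hz => ?_, ?_⟩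
        · push_cast at hz ⊢
          rw [Real.coe_toNNReal C hC.le]
          refine (hvC z).trans (mul_le_mul_of_nonneg_left ?_ hC.le)
          have := norm_le_of_mem_closedBall hz
          linarith
        · push_cast
          rw [Real.coe_toNNReal C hC.le, sub_zero, zero_sub, neg_neg, max_self, hε]
          have : C * (2 * ‖y‖ + 1) * (1 / (2 * C)) = ‖y‖ + 1 / 2 := by
            field_simp
          rw [this]
          linarith
      obtain ⟨γ, hγ0, hγ⟩ := hPL.exists_eq_forall_mem_Icc_hasDerivWithinAt₀
      refine ⟨γ, hγ0, fun t ht => ?_⟩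
      exact hasMFDerivWithinAt_iff_hasFDerivWithinAt.2
        ((hγ t (Ioo_subset_Icc_self ht)).mono Ioo_subset_Icc_self).hasFDerivWithinAt) x
  refine ⟨φ, h0, fun t => ?_⟩
  have h : HasFDerivAt φ ((1 : ℝ →L[ℝ] ℝ).smulRight (v (φ t))) t :=
    hasMFDerivAt_iff_hasFDerivAt.1 (hφ t)
  simpa using h.hasDerivAt

/-! ### Radial fields -/

section Radial

variable {g : ℝ → ℝ}

theorem contDiff_radialField {n : WithTop ℕ∞} (hg : ContDiff ℝ n g) :
    ContDiff ℝ n (radialField g) := by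
  have hc : ∀ i, ContDiff ℝ n fun x : Plane => x i := fun i =>
    (EuclideanSpace.proj (𝕜 := ℝ) i).contDiff
  have hgc : ContDiff ℝ n fun x : Plane => g (x 0 ^ 2 + x 1 ^ 2) :=
    hg.comp (((hc 0).pow 2).add ((hc 1).pow 2))
  refine contDiff_euclidean.2 fun i => ?_
  fin_cases i
  · exact ((hc 0).mul hgc).sub (hc 1)
  · exact ((hc 1).mul hgc).add (hc 0)

theorem norm_radialField_sq (g : ℝ → ℝ) (x : Plane) :
    ‖radialField g x‖ ^ 2 = ‖x‖ ^ 2 * (g (‖x‖ ^ 2) ^ 2 + 1) := by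
  rw [← sq_add_sq_eq_norm_sq, ← sq_add_sq_eq_norm_sq]
  simp only [radialField, PiLp.toLp_apply, Matrix.cons_val_zero, Matrix.cons_val_one]
  ring

theorem norm_radialField_le (hg : ∀ w, |g w| ≤ 2) (x : Plane) :
    ‖radialField g x‖ ≤ 3 * ‖x‖ := by
  refine le_of_sq_le_sq ?_ (by positivity)
  rw [norm_radialField_sq, mul_pow, mul_comm]
  refine mul_le_mul_of_nonneg_right ?_ (sq_nonneg _)
  nlinarith [sq_abs (g (‖x‖ ^ 2)), abs_nonneg (g (‖x‖ ^ 2)), hg (‖x‖ ^ 2)]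

theorem radialField_eq_zero_iff (g : ℝ → ℝ) (x : Plane) : radialField g x = 0 ↔ x = 0 := by
  rw [← norm_eq_zero, ← sq_eq_zero_iff, norm_radialField_sq, mul_eq_zero, sq_eq_zero_iff,
    norm_eq_zero]
  exact or_iff_left (by positivity)

theorem inner_radialField (g : ℝ → ℝ) (x : Plane) :
    inner ℝ x (radialField g x) = ‖x‖ ^ 2 * g (‖x‖ ^ 2) := by
  rw [← sq_add_sq_eq_norm_sq]
  simp only [PiLp.inner_apply, Fin.sum_univ_two, radialField, Matrix.cons_val_zero,
    Matrix.cons_val_one, RCLike.inner_apply, conj_trivial]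
  ring

/-- The squared radius `w` satisfies the autonomous equation `w' = 2 w g(w)`. -/
theorem hasDerivWithinAt_norm_sq {φ : ℝ → Plane} {s : Set ℝ} {t : ℝ}
    (h : HasDerivWithinAt φ (radialField g (φ t)) s t) :
    HasDerivWithinAt (fun t => ‖φ t‖ ^ 2) (2 * (‖φ t‖ ^ 2 * g (‖φ t‖ ^ 2))) s t := by
  rw [← inner_radialField]
  exact h.norm_sq

/-- The squared radius of a trajectory cannot cross a zero `β` of the profile from above: by the
Lipschitz bound, `β - w` stays below the functions `ε exp (M t)` with large `M`. -/
theorem le_norm_sq_of_zero {L β : ℝ} (hL : ∀ x y, |g x - g y| ≤ L * |x - y|)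
    (hgβ : g β = 0) {φ : ℝ → Plane}
    (hφ : ∀ t, 0 ≤ t → HasDerivWithinAt φ (radialField g (φ t)) (Ici 0) t)
    (h0 : β ≤ ‖φ 0‖ ^ 2) {t : ℝ} (ht : 0 ≤ t) : β ≤ ‖φ t‖ ^ 2 := by
  have hL0 : 0 ≤ L := by
    have := (abs_nonneg _).trans (hL 1 0)
    simpa using this
  have hw := fun t (ht : 0 ≤ t) => hasDerivWithinAt_norm_sq (hφ t ht)
  set M := 2 * β * L + 1 with hM
  have key : ∀ ε > 0, β - ‖φ t‖ ^ 2 ≤ ε * Real.exp (M * t) := fun ε hε => by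
    refine image_le_of_deriv_right_lt_deriv_boundary (a := 0) (b := t)
      (f := fun t => β - ‖φ t‖ ^ 2) (f' := fun t => -(2 * (‖φ t‖ ^ 2 * g (‖φ t‖ ^ 2))))
      (B := fun t => ε * Real.exp (M * t)) (B' := fun t => ε * (Real.exp (M * t) * M))
      (fun s hs => ?_) (fun s hs => ?_) ?_ (fun s => ?_) (fun s hs heq => ?_) ⟨ht, le_rfl⟩
    · exact (((hw s hs.1).const_sub β).continuousWithinAt).mono Icc_subset_Ici_self
    · exact ((hw s hs.1).const_sub β).mono (Ici_subset_Ici.2 hs.1)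
    · have : 0 < ε * Real.exp (M * 0) := by positivity
      linarith
    · have := ((hasDerivAt_id s).const_mul M).exp.const_mul ε
      simpa using this
    · have hpos : 0 < ε * Real.exp (M * s) := by positivity
      have hw0 : 0 ≤ ‖φ s‖ ^ 2 := sq_nonneg _
      have hg1 := hL (‖φ s‖ ^ 2) β
      rw [hgβ, sub_zero, abs_sub_comm, heq, abs_of_pos hpos] at hg1
      have hlt : ‖φ s‖ ^ 2 ≤ β := by linarith
      have h2 : -(‖φ s‖ ^ 2 * g (‖φ s‖ ^ 2)) ≤ β * (L * (ε * Real.exp (M * s))) := by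
        calc _ = ‖φ s‖ ^ 2 * -g (‖φ s‖ ^ 2) := by ring
          _ ≤ ‖φ s‖ ^ 2 * (L * (ε * Real.exp (M * s))) :=
            mul_le_mul_of_nonneg_left ((neg_le_abs _).trans hg1) hw0
          _ ≤ _ := mul_le_mul_of_nonneg_right hlt (by positivity)
      rw [hM] at *
      nlinarith
  by_contra! hlt
  have hpos : 0 < β - ‖φ t‖ ^ 2 := sub_pos.2 hlt
  have h := key ((β - ‖φ t‖ ^ 2) / 2 / Real.exp (M * t)) (by positivity)
  rw [div_mul_cancel₀ _ (Real.exp_pos _).ne'] at h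
  linarith

/-- Where the profile is negative up to the initial squared radius, the squared radius decays
exponentially. -/
theorem norm_sq_le_and_tendsto_zero (hg : Continuous g) (hg0 : ∀ w, g w ≤ 0) {φ : ℝ → Plane}
    (hφ : ∀ t, HasDerivAt φ (radialField g (φ t)) t) (hneg : ∀ w ≤ ‖φ 0‖ ^ 2, g w < 0) :
    (∀ t, 0 ≤ t → ‖φ t‖ ^ 2 ≤ ‖φ 0‖ ^ 2) ∧ Tendsto φ atTop (𝓝 0) := by
  have hw : ∀ t, HasDerivAt (fun t => ‖φ t‖ ^ 2) (2 * (‖φ t‖ ^ 2 * g (‖φ t‖ ^ 2))) t := fun t =>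
    (hasDerivWithinAt_norm_sq (hφ t).hasDerivWithinAt).hasDerivAt univ_mem
  have hanti : Antitone fun t => ‖φ t‖ ^ 2 :=
    antitone_of_hasDerivAt_nonpos hw fun t =>
      mul_nonpos_of_nonneg_of_nonpos zero_le_two
        (mul_nonpos_of_nonneg_of_nonpos (sq_nonneg _) (hg0 _))
  refine ⟨fun t ht => hanti ht, ?_⟩
  obtain ⟨w₁, hw₁, hmax⟩ := (isCompact_Icc (a := (0 : ℝ)) (b := ‖φ 0‖ ^ 2)).exists_isMaxOn
    ⟨0, le_rfl, sq_nonneg _⟩ hg.continuousOn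
  set m := -g w₁ with hm
  have hm0 : 0 < m := neg_pos.2 (hneg _ hw₁.2)
  have hdecay : ∀ t, 0 ≤ t → ‖φ t‖ ^ 2 ≤ ‖φ 0‖ ^ 2 * Real.exp (-(2 * m * t)) := fun t ht => by
    have hd : ∀ s, HasDerivAt (fun s => ‖φ s‖ ^ 2 * Real.exp (2 * m * s))
        (2 * (‖φ s‖ ^ 2 * g (‖φ s‖ ^ 2)) * Real.exp (2 * m * s) +
          ‖φ s‖ ^ 2 * (Real.exp (2 * m * s) * (2 * m))) s := fun s => by
      have := ((hasDerivAt_id s).const_mul (2 * m)).exp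
      simp only [id, mul_one] at this
      exact (hw s).mul this
    have hanti' : AntitoneOn (fun s => ‖φ s‖ ^ 2 * Real.exp (2 * m * s)) (Ici 0) := by
      refine antitoneOn_of_hasDerivWithinAt_nonpos (convex_Ici 0)
        (fun s _ => (hd s).continuousAt.continuousWithinAt)
        (fun s _ => (hd s).hasDerivWithinAt) fun s hs => ?_
      rw [interior_Ici] at hs
      have h1 : g (‖φ s‖ ^ 2) ≤ -m := by
        rw [hm, neg_neg]
        exact hmax ⟨sq_nonneg _, hanti (le_of_lt hs)⟩
      have h2 : 2 * (‖φ s‖ ^ 2 * g (‖φ s‖ ^ 2)) * Real.exp (2 * m * s) +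
          ‖φ s‖ ^ 2 * (Real.exp (2 * m * s) * (2 * m)) =
          2 * (‖φ s‖ ^ 2 * Real.exp (2 * m * s)) * (g (‖φ s‖ ^ 2) + m) := by ring
      rw [h2]
      exact mul_nonpos_of_nonneg_of_nonpos (by positivity) (by linarith)
    have := hanti' self_mem_Ici ht ht
    simp only [mul_zero, Real.exp_zero, mul_one] at this
    rw [Real.exp_neg, ← div_eq_mul_inv, le_div_iff₀ (Real.exp_pos _)]
    exact this
  have hexp : Tendsto (fun t => ‖φ 0‖ ^ 2 * Real.exp (-(2 * m * t))) atTop (𝓝 0) := by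
    simpa using (Real.tendsto_exp_neg_atTop_nhds_zero.comp
      (tendsto_id.const_mul_atTop (by positivity : 0 < 2 * m))).const_mul (‖φ 0‖ ^ 2)
  have hsq : Tendsto (fun t => ‖φ t‖ ^ 2) atTop (𝓝 0) :=
    squeeze_zero' (Eventually.of_forall fun _ => sq_nonneg _)
      ((eventually_ge_atTop 0).mono hdecay) hexp
  rw [tendsto_zero_iff_norm_tendsto_zero]
  simpa using hsq.sqrt

/-- The properties of a profile that make the disk `x₁² + x₂² < β` the basin of the origin. -/
structure IsSinkProfile (g : ℝ → ℝ) (β : ℝ) : Prop where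
  contDiff : ContDiff ℝ ∞ g
  abs_le : ∀ w, |g w| ≤ 2
  lipschitz : ∃ L : ℕ, ∀ x y, |g x - g y| ≤ L * |x - y|
  nonpos : ∀ w, g w ≤ 0
  neg : ∀ w < β, g w < 0
  zero : g β = 0
  pos : 0 < β

variable {β : ℝ} {D : Set Plane}

theorem IsSinkProfile.basin_eq (hg : IsSinkProfile g β) (v : C(D, Plane))
    (hv : ∀ x, v x = radialField g x) (hD : {x : Plane | x 0 ^ 2 + x 1 ^ 2 < β} ⊆ D) :
    basin v 0 = {x | x 0 ^ 2 + x 1 ^ 2 < β} := by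
  obtain ⟨L, hL⟩ := hg.lipschitz
  ext x
  constructor
  · rintro ⟨φ, rfl, hφ, hlim⟩
    by_contra hx
    rw [mem_ofPred_eq, not_lt, sq_add_sq_eq_norm_sq] at hx
    have hφ' : ∀ t, 0 ≤ t → HasDerivWithinAt φ (radialField g (φ t)) (Ici 0) t := fun t ht => by
      obtain ⟨y, hy, h⟩ := hφ t ht
      rwa [hv, hy] at h
    have h0 : Tendsto (fun t => ‖φ t‖ ^ 2) atTop (𝓝 0) := by
      simpa using hlim.norm.pow 2
    have := ge_of_tendsto h0 ((eventually_ge_atTop 0).mono fun t ht =>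
      le_norm_sq_of_zero hL hg.zero hφ' hx ht)
    exact absurd hg.pos (not_lt.2 this)
  · intro hx
    rw [mem_ofPred_eq, sq_add_sq_eq_norm_sq] at hx
    obtain ⟨φ, rfl, hφ⟩ := exists_forall_hasDerivAt_of_norm_le
      (contDiff_radialField (hg.contDiff.of_le (by simp))) three_pos
      (norm_radialField_le hg.abs_le) x
    obtain ⟨hle, hlim⟩ := norm_sq_le_and_tendsto_zero hg.contDiff.continuous hg.nonpos hφ
      fun w hw => hg.neg w (hw.trans_lt hx)
    refine ⟨φ, rfl, fun t ht => ⟨⟨φ t, hD ?_⟩, rfl, ?_⟩, hlim⟩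
    · rw [mem_ofPred_eq, sq_add_sq_eq_norm_sq]
      exact (hle t ht).trans_lt hx
    · rw [hv]
      exact (hφ t).hasDerivWithinAt

theorem IsSinkProfile.isSink (hg : IsSinkProfile g β) (v : C(D, Plane))
    (hv : ∀ x, v x = radialField g x) (hD : {x : Plane | x 0 ^ 2 + x 1 ^ 2 < β} ⊆ D) :
    IsSink v 0 := by
  have h0 : (0 : Plane) ∈ {x : Plane | x 0 ^ 2 + x 1 ^ 2 < β} := by
    rw [mem_ofPred_eq]
    simpa using hg.pos
  refine ⟨⟨⟨0, hD h0⟩, rfl, ?_⟩, ?_⟩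
  · rw [hv]
    exact (radialField_eq_zero_iff g 0).2 rfl
  · rw [hg.basin_eq v hv hD]
    refine mem_nhdsWithin_of_mem_nhds (IsOpen.mem_nhds ?_ h0)
    exact isOpen_lt (by fun_prop) continuous_const

end Radial

/-! ### Non-computability of the basin -/

section Noncomputable

variable {g : ℝ → ℝ} {β : ℝ}

theorem isComputablePoint_zero : IsComputablePoint 0 := by
  refine ⟨fun _ => ((0, 0, 0), (0, 0, 0)), Computable.const _, fun k => ?_⟩
  have : RatPointCode.val ((0, 0, 0), (0, 0, 0)) = 0 := by
    ext i
    fin_cases i <;> simp [RatPointCode.val, RatCode.val]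
  rw [this, sub_zero, norm_zero]
  positivity

/-- The point of the positive `x₁`-axis on the circle `x₁² + x₂² = β`. -/
theorem exists_mem_disk_sq_eq (hβ : 0 < β) (hβ' : β ≤ 9) :
    ∃ p ∈ disk 3, p 0 ^ 2 + p 1 ^ 2 = β ∧ p 0 ≠ 0 := by
  have hp : (!₂[√β, 0] : Plane) 0 ^ 2 + (!₂[√β, 0] : Plane) 1 ^ 2 = β := by
    simp [Real.sq_sqrt hβ.le]
  refine ⟨!₂[√β, 0], ?_, hp, by simpa using (Real.sqrt_pos.2 hβ).ne'⟩
  rw [mem_closedBall_zero_iff]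
  refine le_of_sq_le_sq ?_ (by norm_num)
  rw [← sq_add_sq_eq_norm_sq, hp]
  linarith

theorem sq_lt_subset_disk (hβ' : β ≤ 9) : {x : Plane | x 0 ^ 2 + x 1 ^ 2 < β} ⊆ disk 3 := by
  intro x hx
  rw [mem_ofPred_eq, sq_add_sq_eq_norm_sq] at hx
  rw [mem_closedBall_zero_iff]
  refine le_of_sq_le_sq ?_ (by norm_num)
  linarith

theorem IsSinkProfile.not_isComputableOpen_basin (hg : IsSinkProfile g β) (hβ : β ≤ 9)
    (hright : ¬ IsRightComputableReal β) {D : Set Plane} (hD : disk 3 ⊆ D) (v : C(D, Plane))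
    (hv : ∀ x, v x = radialField g x) : ¬ IsComputableOpen D (basin v 0) := by
  rw [hg.basin_eq v hv ((sq_lt_subset_disk hβ).trans hD)]
  obtain ⟨p, hpD, hp, -⟩ := exists_mem_disk_sq_eq hg.pos hβ
  exact fun h => hright (h.2.isRightComputableReal (hD hpD) hp)

theorem IsSinkProfile.mem_inwardFields (hg : IsSinkProfile g β) (hg9 : g 9 < 0)
    (v : C(disk 3, Plane)) (hv : ∀ x, v x = radialField g x) : v ∈ inwardFields 3 := by
  refine ⟨⟨radialField g, (contDiff_radialField (hg.contDiff.of_le (by simp))).contDiffOn,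
    fun x => (hv x).symm⟩, fun x hx => ?_⟩
  rw [hv, inner_radialField, hx]
  norm_num
  linarith

theorem IsSinkProfile.hasNoncomputableBasin (hg : IsSinkProfile g β) (hg9 : g 9 < 0)
    (hcomp : IsComputableOnRat g) (hβ : β ≤ 9) (hleft : IsLeftComputableReal β)
    (hright : ¬ IsRightComputableReal β) (h : C(Plane, Plane)) (hh : ∀ x, h x = radialField g x) :
    HasNoncomputableBasin g β h where
  profile := hh
  smooth := by
    rw [show (h : Plane → Plane) = radialField g from funext hh]
    exact contDiff_radialField hg.contDiff
  computable := by
    obtain ⟨L, hL⟩ := hg.lipschitz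
    exact hcomp.isComputableField hL _ fun x => hh x
  inward := hg.mem_inwardFields hg9 _ fun x => hh x
  equilibrium x := by rw [hh, radialField_eq_zero_iff]
  computable_equilibrium := isComputablePoint_zero
  sink := hg.isSink _ (fun x => hh x) (subset_univ _)
  left_computable := hleft
  not_computable h := hright h.isRightComputableReal
  basin_eq := hg.basin_eq _ (fun x => hh x) (subset_univ _)
  basin_not_computable :=
    hg.not_isComputableOpen_basin hβ hright (subset_univ _) _ fun x => hh x

end Noncomputable

/-! ### Shifts of the Specker profile -/

namespace Specker

/-- The radial profile built from the approximations of a Specker number; its smallest zero is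
the Specker number `limit`. -/
noncomputable def speckerProfile : ℝ → ℝ := profile fun s => ((approx s).val : ℝ)

theorem speckerProfile_neg_of_lt {w : ℝ} (hw : w < limit) : speckerProfile w < 0 := by
  obtain ⟨s, hs⟩ := (tendsto_approx.eventually_const_lt hw).exists
  exact profile_neg_of_lt hs

theorem speckerProfile_limit : speckerProfile limit = 0 :=
  profile_eq_zero approx_le_limit (limit_le_two.trans (by norm_num))

theorem isSinkProfile_shift {δ : ℝ} (hδ : 0 ≤ δ) :
    IsSinkProfile (fun w => speckerProfile (w - δ)) (limit + δ) where
  contDiff := (contDiff_profile _).comp (contDiff_id.sub contDiff_const)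
  abs_le w := abs_profile_le _ _
  lipschitz := by
    obtain ⟨L, hL⟩ := exists_lipschitz_bound_profile fun s => ((approx s).val : ℝ)
    refine ⟨L, fun x y => ?_⟩
    have := hL (x - δ) (y - δ)
    rwa [sub_sub_sub_cancel_right] at this
  nonpos w := profile_nonpos _ _
  neg w hw := speckerProfile_neg_of_lt (sub_lt_iff_lt_add.2 hw)
  zero := by rw [add_sub_cancel_right, speckerProfile_limit]
  pos := by linarith [one_le_limit]

theorem continuous_radialField_shift (δ : ℝ) :
    Continuous (radialField fun w => speckerProfile (w - δ)) :=
  (contDiff_radialField (n := ∞)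
    ((contDiff_profile _).comp (contDiff_id.sub contDiff_const))).continuous

/-- The field whose radial profile is the Specker profile shifted by `δ`. -/
noncomputable def field (δ : ℝ) : C(Plane, Plane) :=
  ⟨radialField fun w => speckerProfile (w - δ), continuous_radialField_shift δ⟩

theorem not_isRightComputableReal_limit_add (δ : ℚ) : ¬ IsRightComputableReal (limit + δ) :=
  fun h => not_isRightComputableReal_limit h.of_add_ratCast

theorem isComputableOnRat_shift (δ : ℚ) : IsComputableOnRat fun w => speckerProfile (w - δ) :=
  (isComputableOnRat_profile computable_approx).comp_sub_const δ

theorem shift_nine_neg {δ : ℝ} (hδ : δ < 1) : speckerProfile (9 - δ) < 0 :=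
  profile_neg_of_four_lt (by linarith)

theorem limit_add_le_nine {δ : ℝ} (hδ : δ < 1) : limit + δ ≤ 9 := by linarith [limit_le_two]

theorem hasNoncomputableBasin_field {δ : ℚ} (h0 : 0 ≤ δ) (h1 : δ < 1) :
    HasNoncomputableBasin (fun w => speckerProfile (w - δ)) (limit + δ) (field δ) :=
  (isSinkProfile_shift (Rat.cast_nonneg.2 h0)).hasNoncomputableBasin
    (shift_nine_neg (by exact_mod_cast h1)) (isComputableOnRat_shift δ)
    (limit_add_le_nine (by exact_mod_cast h1)) (isLeftComputableReal_limit.add_ratCast δ)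
    (not_isRightComputableReal_limit_add δ) _ fun _ => rfl

/-- The restriction to the disk of radius `3` of the shifted field, with its sink `0`. -/
noncomputable def fieldWithSink (δ : ℝ) (h0 : 0 ≤ δ) (h1 : δ < 1) : FieldWithSink 3 :=
  ⟨((field δ).restrict (disk 3), 0),
    (isSinkProfile_shift h0).mem_inwardFields (shift_nine_neg h1) _ fun _ => rfl,
    (isSinkProfile_shift h0).isSink _ (fun _ => rfl) (sq_lt_subset_disk (limit_add_le_nine h1))⟩

theorem isComputable_fieldWithSink (δ : ℚ) (h0 : (0 : ℝ) ≤ δ) (h1 : (δ : ℝ) < 1) :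
    (fieldWithSink δ h0 h1).IsComputable := by
  obtain ⟨L, hL⟩ := (isSinkProfile_shift h0).lipschitz
  exact ⟨(isComputableOnRat_shift δ).isComputableField hL _ fun _ => rfl, isComputablePoint_zero⟩

theorem not_isComputableOpen_basinMap (δ : ℚ) (h0 : (0 : ℝ) ≤ δ) (h1 : (δ : ℝ) < 1) :
    ¬ IsComputableOpen (disk 3) (basinMap 3 (fieldWithSink δ h0 h1)) :=
  (isSinkProfile_shift h0).not_isComputableOpen_basin (limit_add_le_nine h1)
    (not_isRightComputableReal_limit_add δ) Subset.rfl _ fun _ => rfl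

/-- At a point of the circle `x₁² + x₂² = limit` off the `x₂`-axis, the profile vanishes, while
any proper right shift of it is negative. -/
theorem restrict_field_ne {δ : ℝ} (hδ : 0 < δ) :
    (field δ).restrict (disk 3) ≠ (field 0).restrict (disk 3) := by
  intro h
  obtain ⟨p, hpD, hp, hp0⟩ := exists_mem_disk_sq_eq (zero_lt_one.trans_le one_le_limit)
    (limit_le_two.trans (by norm_num))
  have h1 : radialField (fun w => speckerProfile (w - δ)) p =
      radialField (fun w => speckerProfile (w - 0)) p := DFunLike.congr_fun h (⟨p, hpD⟩ : disk 3)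
  have h2 := congrArg (fun y : Plane => y 0) h1
  simp only [radialField, hp, sub_zero, speckerProfile_limit, PiLp.toLp_apply,
    Matrix.cons_val_zero, sub_left_inj, mul_zero, mul_eq_zero, hp0, false_or] at h2
  exact (speckerProfile_neg_of_lt (sub_lt_self limit hδ)).ne h2

theorem norm_field_sub_le {L : ℝ} (hL : ∀ x y, |speckerProfile x - speckerProfile y| ≤ L * |x - y|)
    (δ : ℝ) (x : Plane) : ‖field δ x - field 0 x‖ ≤ ‖x‖ * (L * |δ|) := by
  have h : field δ x - field 0 x =
      (speckerProfile (x 0 ^ 2 + x 1 ^ 2 - δ) - speckerProfile (x 0 ^ 2 + x 1 ^ 2)) • x := by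
    ext i
    fin_cases i <;> simp [field, radialField] <;> ring
  rw [h, norm_smul, mul_comm]
  refine mul_le_mul_of_nonneg_left ((hL _ _).trans_eq ?_) (norm_nonneg _)
  rw [sub_sub_cancel_left, abs_neg]

/-- The shifted fields converge uniformly on the disk, by the Lipschitz bound of the profile. -/
theorem tendsto_restrict_field :
    Tendsto (fun δ : ℝ => (field δ).restrict (disk 3)) (𝓝 0) (𝓝 ((field 0).restrict (disk 3))) := by
  obtain ⟨L, hL⟩ := exists_lipschitz_bound_profile fun s => ((approx s).val : ℝ)
  have : CompactSpace (disk 3) := isCompact_iff_compactSpace.1 (isCompact_closedBall 0 3)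
  rw [tendsto_iff_dist_tendsto_zero]
  refine squeeze_zero (fun _ => dist_nonneg) (g := fun δ => 3 * (L * |δ|)) (fun δ => ?_) ?_
  · refine (ContinuousMap.dist_le (by positivity)).2 fun x => ?_
    rw [dist_eq_norm]
    refine (norm_field_sub_le hL δ x).trans ?_
    exact mul_le_mul_of_nonneg_right (mem_closedBall_zero_iff.1 x.2) (by positivity)
  · have : Continuous fun δ : ℝ => 3 * (L * |δ|) := by fun_prop
    simpa using this.tendsto 0

theorem exists_rat_restrict_field_mem {U : Set C(disk 3, Plane)}
    (hU : U ∈ 𝓝 ((field 0).restrict (disk 3))) :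
    ∃ δ : ℚ, 0 < δ ∧ δ < 1 ∧ (field δ).restrict (disk 3) ∈ U := by
  obtain ⟨ε, hε, h⟩ := Metric.mem_nhds_iff.1 (tendsto_restrict_field hU)
  obtain ⟨δ, hδ0, hδ⟩ := exists_rat_btwn (lt_min hε one_pos)
  refine ⟨δ, by exact_mod_cast hδ0, by exact_mod_cast hδ.trans_le (min_le_right _ _),
    @h (δ : ℝ) ?_⟩
  rw [Metric.mem_ball, Real.dist_eq, sub_zero, abs_of_pos hδ0]
  exact hδ.trans_le (min_le_left _ _)

end Specker

theorem mainTheorem6 :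
    ∃ (f : ℝ → ℝ) (α : ℝ) (h : C(Plane, Plane)),
      ContDiff ℝ ∞ f ∧ HasNoncomputableBasin f α h ∧
      (∀ U ∈ 𝓝[inwardFields 3] (h.restrict (disk 3)),
        ∃ (δ : ℚ) (h' : C(Plane, Plane)), 0 < δ ∧ δ < 1 ∧
          h'.restrict (disk 3) ∈ U ∧ h'.restrict (disk 3) ≠ h.restrict (disk 3) ∧
          HasNoncomputableBasin (fun w => f (w - δ)) (α + δ) h') ∧
      ∃ x : FieldWithSink 3, x.1 = (h.restrict (disk 3), 0) ∧
        SemiRobustlyNoncomputableAt FieldWithSink.IsComputable (IsComputableOpen (disk 3))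
          (basinMap 3) x := by
  have hbase : HasNoncomputableBasin Specker.speckerProfile Specker.limit (Specker.field 0) := by
    have := Specker.hasNoncomputableBasin_field le_rfl one_pos
    simpa using this
  refine ⟨Specker.speckerProfile, Specker.limit, Specker.field 0, contDiff_profile _, hbase,
    fun U hU => ?_, Specker.fieldWithSink 0 le_rfl one_pos, rfl, ?_, ?_, fun U hU => ?_⟩
  · obtain ⟨V, hV, hVU⟩ := mem_nhdsWithin_iff_exists_mem_nhds_inter.1 hU
    obtain ⟨δ, h0, h1, hδ⟩ := Specker.exists_rat_restrict_field_mem hV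
    have h := Specker.hasNoncomputableBasin_field h0.le h1
    exact ⟨δ, Specker.field δ, h0, h1, hVU ⟨hδ, h.inward⟩,
      Specker.restrict_field_ne (Rat.cast_pos.2 h0), h⟩
  · simpa using Specker.isComputable_fieldWithSink 0 (by simp) (by simp)
  · simpa using Specker.not_isComputableOpen_basinMap 0 (by simp) (by simp)
  · obtain ⟨V, hV, hVU⟩ := mem_nhds_subtype _ _ _ |>.1 hU
    have hV' : (fun v : C(disk 3, Plane) => (v, (0 : Plane))) ⁻¹' V ∈
        𝓝 ((Specker.field 0).restrict (disk 3)) :=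
      (Continuous.prodMk_left (0 : Plane)).continuousAt.preimage_mem_nhds hV
    obtain ⟨δ, h0, h1, hδ⟩ := Specker.exists_rat_restrict_field_mem hV'
    have h0' : (0 : ℝ) < δ := Rat.cast_pos.2 h0
    have h1' : (δ : ℝ) < 1 := by exact_mod_cast h1
    refine ⟨Specker.fieldWithSink δ h0'.le h1', hVU hδ,
      Specker.isComputable_fieldWithSink δ _ _, fun h => ?_,
      Specker.not_isComputableOpen_basinMap δ _ _⟩
    exact Specker.restrict_field_ne h0' (congrArg (fun p : FieldWithSink 3 => p.1.1) h)
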